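/- All matroids are finite. A matroid is regular if it can be represented over $\mathbb{R}$ by a totally unimodular matrix (equivalently, it is binary and has no minor isomorphic to $F_7$ or $F_7^*$). For a matroid $M$ with ground set $E$ and rank function $r$, put $\lambda_M(X)=r(X)+r(E-X)-r(M)$ for $X\subseteq E$. An exact $k$-separation of $M$ is a partition $(X,Y)$ of $E$ with $|X|\ge k$, $|Y|\ge k$ and $\lambda_M(X)=k-1$. Let $R_{12}$ be the matroid on $\{1,\dots,12\}$ in which $i$ is the $i$-th column of the matrix $[I_6\mid D]$ over $GF(2)$, where $$D=\begin{pmatrix}1&1&1&0&0&0\\1&1&0&1&0&0\\1&0&0&0&1&0\\0&1&0&0&0&1\\0&0&1&0&1&1\\0&0&0&1&1&1\end{pmatrix},$$ and let $A=\{3,4,7,8,11,12\}$, $B=\{1,2,5,6,9,10\}$. **Theorem 4.1.** The matroid $R_{12}$ is a 3-decomposer for the class of regular matroids, with inducer $(A,B)$. That is: $R_{12}$ is regular, $(A,B)$ is an exact 3-separation of $R_{12}$, and, whenever $M$ is a regular matroid and $\varphi$ is an isomorphism from $R_{12}$ onto a minor of $M$, the matroid $M$ has an exact 3-separation $(X,Y)$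 with $\varphi(A)\subseteq X$ and $\varphi(B)\subseteq Y$. -/

import Mathlib

universe u v w

noncomputable section

open Set

namespace Matroid

/-- Augmentation for linear independence of finite families. -/
lemma exists_linearIndepOn_insert {K : Type u} {V : Type v} {α : Type w} [Field K]
    [AddCommGroup V] [Module K V] [Finite α] (f : α → V) {I J : Set α}
    (hI : LinearIndepOn K f I) (hJ : LinearIndepOn K f J) (h : I.ncard < J.ncard) :
    ∃ e ∈ J, e ∉ I ∧ LinearIndepOn K f (insert e I) := by
  classical
  by_contra! hcon
  have hsub : ∀ e ∈ J, f e ∈ Submodule.span K (f '' I) := by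
    intro e he
    by_cases heI : e ∈ I
    · exact Submodule.subset_span ⟨e, heI, rfl⟩
    · by_contra hns
      exact hcon e he heI ((linearIndepOn_insert heI).2 ⟨hI, hns⟩)
  have hle : Submodule.span K (f '' J) ≤ Submodule.span K (f '' I) := by
    rw [Submodule.span_le]
    rintro _ ⟨e, he, rfl⟩
    exact hsub e he
  have : Fintype I := Fintype.ofFinite I
  have : Fintype J := Fintype.ofFinite J
  have hfin : Module.Finite K (Submodule.span K (f '' I)) :=
    Module.Finite.span_of_finite K (Set.toFinite _)
  have h1 := finrank_span_eq_card hI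
  have h2 := finrank_span_eq_card hJ
  have hrI : Set.range (fun x : I ↦ f x) = f '' I := by ext; simp
  have hrJ : Set.range (fun x : J ↦ f x) = f '' J := by ext; simp
  rw [hrI] at h1
  rw [hrJ] at h2
  have h3 := Submodule.finrank_mono hle
  rw [h1, h2] at h3
  rw [Set.ncard_eq_toFinset_card', Set.ncard_eq_toFinset_card', Set.toFinset_card,
    Set.toFinset_card] at h
  omega

/-- The vector matroid `M[A]`: the ground set is the set of all columns of `A`, and a set of columns
is independent when it is linearly independent (as a family) over the field `K`. -/
def ofColumns {K : Type u} {m : Type v} {α : Type w} [Field K] [Finite α]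
    (A : Matrix m α K) : Matroid α :=
  (IndepMatroid.ofFinite (E := Set.univ) Set.finite_univ
    (fun I ↦ LinearIndepOn K A.col I)
    (linearIndepOn_empty K _)
    (fun _ _ hJ hIJ ↦ hJ.mono hIJ)
    (fun _ _ hI hJ h ↦ exists_linearIndepOn_insert A.col hI hJ h)
    (fun I _ ↦ Set.subset_univ I)).matroid

/-- A matroid is regular when its ground set is finite and it can be represented over `ℝ` by a
totally unimodular matrix. (Columns of `A` outside the ground set play no role.) -/
def IsRegular {α : Type u} (M : Matroid α) : Prop :=
  M.E.Finite ∧ ∃ (n : ℕ) (A : Matrix (Fin n) α ℝ), A.IsTotallyUnimodular ∧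
    ∀ I ⊆ M.E, (M.Indep I ↔ LinearIndepOn ℝ A.col I)

/-- The connectivity function `λ_M(X) = r(X) + r(E - X) - r(M)`. The rank function is valued in
`ℕ∞`; for a finite matroid all ranks are finite, and submodularity makes the subtraction exact. -/
def conn {α : Type u} (M : Matroid α) (X : Set α) : ℕ∞ :=
  M.eRk X + M.eRk (M.E \ X) - M.eRank

/-- `(X, Y)` is an exact `k`-separation of `M`: a partition of the ground set with `|X| ≥ k`,
`|Y| ≥ k` and `λ_M(X) = k - 1`. -/
structure IsExactSeparation {α : Type u} (M : Matroid α) (k : ℕ) (X Y : Set α) : Prop where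
  union_eq : X ∪ Y = M.E
  disjoint : Disjoint X Y
  le_encard_left : (k : ℕ∞) ≤ X.encard
  le_encard_right : (k : ℕ∞) ≤ Y.encard
  conn_add_one : M.conn X + 1 = k

/-- `N` is a `k`-decomposer, with inducer `(A, B)`, for the class `𝓜` of matroids:
`(A, B)` is an exact `k`-separation of `N`, and for every `M` in `𝓜` and every minor of `M`
isomorphic to `N`, the copy of `(A, B)` in that minor extends to an exact `k`-separation
`(X, Y)` of `M`. The isomorphism from `N` onto the minor is the injection `φ`. -/
def IsDecomposer {β : Type v} (N : Matroid β) (k : ℕ) (A B : Set β)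
    (𝓜 : ∀ α : Type u, Matroid α → Prop) : Prop :=
  N.IsExactSeparation k A B ∧
    ∀ (α : Type u) (M : Matroid α), 𝓜 α M →
      ∀ (φ : β → α) (hφ : Set.InjOn φ N.E), N.map φ hφ ≤m M →
        ∃ X Y : Set α, M.IsExactSeparation k X Y ∧ φ '' A ⊆ X ∧ φ '' B ⊆ Y

/-- The standard binary representation `[I₆ | D]` of `R₁₂`. The element called `i` in the
mathematical text (`1 ≤ i ≤ 12`) is the `i`-th column, that is, the index `i - 1` of `Fin 12`. -/
def R12Matrix : Matrix (Fin 6) (Fin 12) (ZMod 2) :=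
  !![1, 0, 0, 0, 0, 0, 1, 1, 1, 0, 0, 0;
     0, 1, 0, 0, 0, 0, 1, 1, 0, 1, 0, 0;
     0, 0, 1, 0, 0, 0, 1, 0, 0, 0, 1, 0;
     0, 0, 0, 1, 0, 0, 0, 1, 0, 0, 0, 1;
     0, 0, 0, 0, 1, 0, 0, 0, 1, 0, 1, 1;
     0, 0, 0, 0, 0, 1, 0, 0, 0, 1, 1, 1]

/-- The 12-element, rank-6 binary matroid `R₁₂`. -/
def R12 : Matroid (Fin 12) := ofColumns R12Matrix

/-- The side `{3, 4, 7, 8, 11, 12}`, in the labelling of the columns by `1, …, 12`. -/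
def R12A : Set (Fin 12) := {i | (i : ℕ) + 1 ∈ ({3, 4, 7, 8, 11, 12} : Set ℕ)}

/-- The side `{1, 2, 5, 6, 9, 10}`, in the labelling of the columns by `1, …, 12`. -/
def R12B : Set (Fin 12) := {i | (i : ℕ) + 1 ∈ ({1, 2, 5, 6, 9, 10} : Set ℕ)}

end Matroid

end

/-! Extend the copy of the basis {1,…,6} of R₁₂, together with a basis of the contracted set, to a
basis of M, and pivot a totally unimodular representation to [I | P] over it. By `exists_signs`,
total unimodularity fixes the signs of the block of P belonging to R₁₂ up to scaling
(`HasR12Block`). Call the elements of A left and those of B right; counting from 0, the left ones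
are rows 2, 3 and columns 0, 1, 4, 5 of the block. A partition extending (A, B) is the wanted
separation once left rows vanish on right columns and the block of right rows against left columns
is determined by rows ρ 0, ρ 4 and columns κ 0, κ 4: the ranks 0 and 2 of the two blocks add up to λ
= 2 (`conn_add_one_eq_three`).

Under these conditions a left row forces the columns where it is nonzero to the left, and a left
column forces the rows with nonzero `deviation`. It suffices that no chain of forcing steps leads
from a left to a right element of R₁₂. Take a chain that is shortest over all totally unimodular
matrices and all R₁₂ blocks in them. Its second element is forced by R₁₂ directly, and minors of
order at most 4 leave few possibilities for its restriction to R₁₂ (`column_cases`, `row_cases`): it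
is parallel to or in series with a left element, or it is the column ±(0,0,1,-1,0,0). In the first
case it can be exchanged into the copy of R₁₂, by relabelling or by a pivot, which saves one step.
In the second case the third element is a row vanishing on R₁₂, and pivoting on the two saves two
steps. So there is no chain (`noShortChain`).

R₁₂ is regular because its signing is totally unimodular and independence of columns of such a
matrix does not depend on the field. Its own separation is the case M = R₁₂. -/

namespace Matrix

/-! ### Pivoting and scaling totally unimodular matrices. -/

section TotallyUnimodular

variable {m n R : Type*} [CommRing R]

lemma range_signType_cast_mul {a b : R} (ha : a ∈ Set.range (SignType.cast : SignType → R))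
    (hb : b ∈ Set.range (SignType.cast : SignType → R)) :
    a * b ∈ Set.range (SignType.cast : SignType → R) := by
  obtain ⟨x, rfl⟩ := ha
  obtain ⟨y, rfl⟩ := hb
  exact ⟨x * y, by simp⟩

lemma mul_self_of_mem_range_signType_cast {a : R}
    (ha : a ∈ Set.range (SignType.cast : SignType → R)) (h0 : a ≠ 0) : a * a = 1 := by
  obtain ⟨x, rfl⟩ := ha
  cases x <;> simp_all

/-- The row operations that clear column `e` outside row `g`, when the entry `A g e` is its own
inverse. -/
def rowPivot [DecidableEq m] (A : Matrix m n R) (g : m) (e : n) : Matrix m n R :=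
  fun f v ↦ if f = g then A g v else A f v - A f e * A g e * A g v

lemma rowPivot_self [DecidableEq m] (A : Matrix m n R) (g : m) (e : n) (v : n) :
    A.rowPivot g e g v = A g v := by simp [rowPivot]

lemma rowPivot_of_ne [DecidableEq m] (A : Matrix m n R) {g f : m} (h : f ≠ g) (e v : n) :
    A.rowPivot g e f v = A f v - A f e * A g e * A g v := by simp [rowPivot, h]

lemma rowPivot_of_eq_zero [DecidableEq m] (A : Matrix m n R) {g f : m} {e v : n}
    (h : A f e * A g v = 0) : A.rowPivot g e f v = A f v := by
  by_cases hf : f = g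
  · simp [rowPivot, hf]
  · rw [rowPivot_of_ne A hf]
    linear_combination (-A g e) * h

/-- If the chosen rows include `g`, the row operations stay inside the submatrix and preserve its
determinant. Otherwise adjoin row `g` and column `e`: the pivoted column `e` has the single nonzero
entry `A g e`, a unit, so expanding along it recovers the original minor. -/
lemma IsTotallyUnimodular.rowPivot [DecidableEq m] {A : Matrix m n R}
    (hA : A.IsTotallyUnimodular) {g : m} {e : n} (hge : A g e * A g e = 1) :
    (A.rowPivot g e).IsTotallyUnimodular := by
  have hA' := (isTotallyUnimodular_iff A).1 hA
  have key : ∀ (k : ℕ) (f : Fin k → m) (c : Fin k → n), f.Injective → (∃ i, f i = g) →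
      ((A.rowPivot g e).submatrix f c).det ∈ Set.range SignType.cast := by
    rintro k f c hf ⟨i, hi⟩
    rw [det_eq_of_forall_row_eq_smul_add_const (B := A.submatrix f c)
      (fun j ↦ if j = i then 0 else -(A (f j) e * A g e)) i (by simp)]
    · exact hA' k f c
    · intro j l
      by_cases hj : j = i
      · simp [hj, hi, Matrix.rowPivot]
      · have : f j ≠ g := fun h ↦ hj (hf (h.trans hi.symm))
        simp [hj, hi, rowPivot_of_ne A this]
        ring
  intro k f c hf _
  by_cases hg : ∃ i, f i = g
  · exact key k f c hf hg
  have hinj : (Fin.cons g f : Fin (k + 1) → m).Injective := by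
    rw [Fin.cons_injective_iff]
    exact ⟨fun ⟨i, hi⟩ ↦ hg ⟨i, hi⟩, hf⟩
  have h1 := key (k + 1) (Fin.cons g f) (Fin.cons e c) hinj ⟨0, rfl⟩
  rw [det_succ_column_zero, Fin.sum_univ_succ, Finset.sum_eq_zero] at h1
  · have h2 := range_signType_cast_mul (hA.apply g e) h1
    simp only [submatrix_apply, Fin.cons_zero, submatrix_submatrix, rowPivot_self] at h2
    convert h2 using 1
    have h3 : ((Fin.cons g f : Fin (k + 1) → m) ∘ (Fin.succAbove 0)) = f := by
      ext i; simp
    have h4 : ((Fin.cons e c : Fin (k + 1) → n) ∘ Fin.succ) = c := by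
      ext i; simp
    rw [h3, h4]
    simp only [Fin.val_zero, pow_zero, one_mul, add_zero]
    rw [← mul_assoc, hge, one_mul]
  · intro i _
    have : f i ≠ g := fun h ↦ hg ⟨i, h⟩
    simp only [submatrix_apply, Fin.cons_succ, Fin.cons_zero, rowPivot_of_ne A this]
    have : A (f i) e - A (f i) e * A g e * A g e = 0 := by linear_combination (-A (f i) e) * hge
    rw [this]; ring

lemma IsTotallyUnimodular.scale {A : Matrix m n R} (hA : A.IsTotallyUnimodular)
    {s : m → R} {t : n → R} (hs : ∀ i, s i ∈ Set.range (SignType.cast : SignType → R))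
    (ht : ∀ j, t j ∈ Set.range (SignType.cast : SignType → R)) :
    (Matrix.of fun i j ↦ s i * t j * A i j).IsTotallyUnimodular := by
  intro k f c hf hc
  have hprod : ∀ (x : Fin k → R), (∀ i, x i ∈ Set.range (SignType.cast : SignType → R)) →
      ∏ i, x i ∈ Set.range (SignType.cast : SignType → R) := by
    intro x hx
    refine Finset.prod_induction _ (· ∈ Set.range (SignType.cast : SignType → R))
      (fun _ _ ↦ range_signType_cast_mul) ⟨1, by simp⟩ (fun i _ ↦ hx i)
  have : (Matrix.of fun i j ↦ s i * t j * A i j).submatrix f c =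
      Matrix.of fun i j ↦ (s ∘ f) i * (Matrix.of fun i j ↦ (t ∘ c) j * A.submatrix f c i j) i j := by
    ext i j; simp [mul_assoc]
  rw [this, det_mul_column, det_mul_row]
  exact range_signType_cast_mul (hprod _ fun i ↦ hs _)
    (range_signType_cast_mul (hprod _ fun i ↦ ht _) (hA k f c hf hc))

end TotallyUnimodular

/-! ### Explicit bounds on minors of order at most four. -/

section Int

variable {m n : Type*} {T : Matrix m n ℤ}

lemma abs_le_one_of_mem_range_signType_cast {a : ℤ}
    (ha : a ∈ Set.range (SignType.cast : SignType → ℤ)) : |a| ≤ 1 := by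
  obtain ⟨x, rfl⟩ := ha
  cases x <;> simp

lemma IsTotallyUnimodular.abs_le_one (hT : T.IsTotallyUnimodular) (i : m) (j : n) :
    |T i j| ≤ 1 :=
  abs_le_one_of_mem_range_signType_cast (hT.apply i j)

lemma IsTotallyUnimodular.abs_det_two_le (hT : T.IsTotallyUnimodular) (i₀ i₁ : m) (j₀ j₁ : n) :
    |T i₀ j₀ * T i₁ j₁ - T i₀ j₁ * T i₁ j₀| ≤ 1 := by
  have := abs_le_one_of_mem_range_signType_cast
    ((isTotallyUnimodular_iff T).1 hT 2 ![i₀, i₁] ![j₀, j₁])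
  rw [det_fin_two] at this
  simpa only [submatrix_apply, cons_val_zero, cons_val_one] using this

lemma IsTotallyUnimodular.abs_det_three_le (hT : T.IsTotallyUnimodular) (i₀ i₁ i₂ : m)
    (j₀ j₁ j₂ : n) :
    |T i₀ j₀ * (T i₁ j₁ * T i₂ j₂ - T i₁ j₂ * T i₂ j₁)
      - T i₀ j₁ * (T i₁ j₀ * T i₂ j₂ - T i₁ j₂ * T i₂ j₀)
      + T i₀ j₂ * (T i₁ j₀ * T i₂ j₁ - T i₁ j₁ * T i₂ j₀)| ≤ 1 := by
  have := abs_le_one_of_mem_range_signType_cast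
    ((isTotallyUnimodular_iff T).1 hT 3 ![i₀, i₁, i₂] ![j₀, j₁, j₂])
  rw [det_fin_three] at this
  simp only [submatrix_apply, cons_val_zero, cons_val_one, cons_val] at this
  convert this using 2
  ring

lemma IsTotallyUnimodular.abs_det_four_le (hT : T.IsTotallyUnimodular) (i₀ i₁ i₂ i₃ : m)
    (j₀ j₁ j₂ j₃ : n) :
    |T i₀ j₀ * (T i₁ j₁ * (T i₂ j₂ * T i₃ j₃ - T i₂ j₃ * T i₃ j₂)
          - T i₁ j₂ * (T i₂ j₁ * T i₃ j₃ - T i₂ j₃ * T i₃ j₁)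
          + T i₁ j₃ * (T i₂ j₁ * T i₃ j₂ - T i₂ j₂ * T i₃ j₁))
      - T i₀ j₁ * (T i₁ j₀ * (T i₂ j₂ * T i₃ j₃ - T i₂ j₃ * T i₃ j₂)
          - T i₁ j₂ * (T i₂ j₀ * T i₃ j₃ - T i₂ j₃ * T i₃ j₀)
          + T i₁ j₃ * (T i₂ j₀ * T i₃ j₂ - T i₂ j₂ * T i₃ j₀))
      + T i₀ j₂ * (T i₁ j₀ * (T i₂ j₁ * T i₃ j₃ - T i₂ j₃ * T i₃ j₁)
          - T i₁ j₁ * (T i₂ j₀ * T i₃ j₃ - T i₂ j₃ * T i₃ j₀)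
          + T i₁ j₃ * (T i₂ j₀ * T i₃ j₁ - T i₂ j₁ * T i₃ j₀))
      - T i₀ j₃ * (T i₁ j₀ * (T i₂ j₁ * T i₃ j₂ - T i₂ j₂ * T i₃ j₁)
          - T i₁ j₁ * (T i₂ j₀ * T i₃ j₂ - T i₂ j₂ * T i₃ j₀)
          + T i₁ j₂ * (T i₂ j₀ * T i₃ j₁ - T i₂ j₁ * T i₃ j₀))| ≤ 1 := by
  have := abs_le_one_of_mem_range_signType_cast
    ((isTotallyUnimodular_iff T).1 hT 4 ![i₀, i₁, i₂, i₃] ![j₀, j₁, j₂, j₃])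
  rw [det_succ_row_zero] at this
  simp only [Fin.sum_univ_four, det_fin_three, submatrix_apply] at this
  simp [Fin.succAbove, Fin.lt_def] at this
  convert this using 2
  ring

end Int

end Matrix

/-! ### Rows and columns adjoined to the signed R₁₂ block, and uniqueness of its signing. -/

namespace Matroid

open Matrix

/-- The totally unimodular signing of the matrix `D` in the representation `[I₆ | D]` of `R₁₂`. -/
def signedD : Matrix (Fin 6) (Fin 6) ℤ :=
  !![1, 1, 1, 0, 0, 0;
     1, 1, 0, 1, 0, 0;
     1, 0, 0, 0, 1, 0;
     0, 1, 0, 0, 0, 1;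
     0, 0, 1, 0, -1, -1;
     0, 0, 0, 1, -1, -1]

lemma signedD_transpose : signedDᵀ = signedD := by decide

/-- The constraints imposed by total unimodularity on a column appended to `signedD`. -/
def ColumnConstraints (c₀ c₁ c₂ c₃ c₄ c₅ : ℤ) : Prop :=
  |c₀ - c₁ - c₂ - c₄| ≤ 1 ∧ |c₁ - c₂ - c₃ - c₅| ≤ 1 ∧ |c₀ - c₃ - c₄ + c₅| ≤ 1 ∧
  |c₀ - c₃ - c₅| ≤ 1 ∧ |c₁ - c₂ - c₄| ≤ 1 ∧ |c₀ - c₁ + c₃ + c₅| ≤ 1 ∧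
  |c₁ - c₂ + c₄ - c₅| ≤ 1 ∧ |c₀ - c₄| ≤ 1 ∧ |c₀ - c₂ - c₃| ≤ 1 ∧ |c₂ + c₃ + c₄| ≤ 1 ∧
  |c₀ - c₂ - c₅| ≤ 1 ∧ |c₁ - c₃ - c₄| ≤ 1 ∧ |c₀ - c₁ + c₂ + c₅| ≤ 1 ∧
  |c₀ - c₁ - c₃ - c₄| ≤ 1 ∧ |c₀ - c₂ - c₄ + c₅| ≤ 1 ∧ |c₁ - c₃ + c₄ - c₅| ≤ 1

instance (c₀ c₁ c₂ c₃ c₄ c₅ : ℤ) : Decidable (ColumnConstraints c₀ c₁ c₂ c₃ c₄ c₅) := by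
  unfold ColumnConstraints
  infer_instance

/-- Each constraint is a minor whose last column is `e`. The other columns come from `signedD`, so
the minor is a linear form in the entries of `e` with known coefficients. -/
lemma columnConstraints {m n : Type*} {T : Matrix m n ℤ} (hT : T.IsTotallyUnimodular)
    {ρ : Fin 6 → m} {κ : Fin 6 → n} (h : ∀ i j, T (ρ i) (κ j) = signedD i j) (e : n) :
    ColumnConstraints (T (ρ 0) e) (T (ρ 1) e) (T (ρ 2) e) (T (ρ 3) e) (T (ρ 4) e) (T (ρ 5) e) := by
  have two := fun a b x ↦ hT.abs_det_two_le (ρ a) (ρ b) (κ x) e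
  have three := fun a b c x y ↦ hT.abs_det_three_le (ρ a) (ρ b) (ρ c) (κ x) (κ y) e
  have four := fun a b c d x y z ↦
    hT.abs_det_four_le (ρ a) (ρ b) (ρ c) (ρ d) (κ x) (κ y) (κ z) e
  simp only [h] at two three four
  refine ⟨?_, ?_, ?_, ?_, ?_, ?_, ?_, ?_, ?_, ?_, ?_, ?_, ?_, ?_, ?_, ?_⟩
  · have := four 0 1 2 4 1 2 4
    simp [signedD] at this
    grind
  · have := four 1 2 3 5 0 1 3
    simp [signedD] at this
    grind
  · have := four 0 3 4 5 1 2 4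
    simp [signedD] at this
    grind
  · have := three 0 3 5 1 5
    simp [signedD] at this
    grind
  · have := three 1 2 4 0 4
    simp [signedD] at this
    grind
  · have := four 0 1 3 5 0 3 5
    simp [signedD] at this
    grind
  · have := four 1 2 4 5 0 3 5
    simp [signedD] at this
    grind
  · have := two 0 4 2
    simp [signedD] at this
    grind
  · have := three 0 2 3 0 1
    simp [signedD] at this
    grind
  · have := three 2 3 4 4 5
    simp [signedD] at this
    grind
  · have := three 0 2 5 0 4
    simp [signedD] at this
    grind
  · have := three 1 3 4 1 5
    simp [signedD] at this
    grind
  · have := four 0 1 2 5 1 3 4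
    simp [signedD] at this
    grind
  · have := four 0 1 3 4 0 2 5
    simp [signedD] at this
    grind
  · have := four 0 2 4 5 0 2 5
    simp [signedD] at this
    grind
  · have := four 1 3 4 5 1 3 4
    simp [signedD] at this
    grind

/-- The possible restrictions to the rows of `R₁₂` of a column that is forced to the side of the
columns of index `0, 1, 4, 5`: up to sign, a unit column, a column of `signedD`, or one further
column. -/
def LeftColumn (c : Fin 6 → ℤ) : Prop :=
  c 1 = c 0 ∧ c 5 = c 4 ∧ ∃ s ∈ ([1, -1] : List ℤ),
    (∃ k ∈ ([2, 3] : List (Fin 6)), ∀ i, c i = if i = k then s else 0) ∨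
    (∃ a ∈ ([0, 1, 4, 5] : List (Fin 6)), ∀ i, c i = s * signedD i a) ∨
    (∀ i, c i = s * ![0, 0, 1, -1, 0, 0] i)

/-- The possible restrictions to the columns of `R₁₂` of a row that is forced to the side of the
rows of index `2, 3`. -/
def LeftRow (c : Fin 6 → ℤ) : Prop :=
  c 2 = 0 ∧ c 3 = 0 ∧ ∃ s ∈ ([1, -1] : List ℤ),
    (∃ k ∈ ([0, 1, 4, 5] : List (Fin 6)), ∀ i, c i = if i = k then s else 0) ∨
    (∃ a ∈ ([2, 3] : List (Fin 6)), ∀ i, c i = s * signedD a i)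

instance (c : Fin 6 → ℤ) : Decidable (LeftColumn c) := by
  unfold LeftColumn
  infer_instance

instance (c : Fin 6 → ℤ) : Decidable (LeftRow c) := by
  unfold LeftRow
  infer_instance

/-- A search through the 3⁶ sign vectors. Since `signedD` is symmetric, the same constraints hold
for adjoined rows, so one search yields both classifications. -/
lemma columnConstraints_cases : ∀ c₀ ∈ ([-1, 0, 1] : List ℤ), ∀ c₁ ∈ ([-1, 0, 1] : List ℤ),
    ∀ c₂ ∈ ([-1, 0, 1] : List ℤ), ∀ c₃ ∈ ([-1, 0, 1] : List ℤ), ∀ c₄ ∈ ([-1, 0, 1] : List ℤ),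
    ∀ c₅ ∈ ([-1, 0, 1] : List ℤ), ColumnConstraints c₀ c₁ c₂ c₃ c₄ c₅ →
      ((c₂ ≠ 0 ∨ c₃ ≠ 0) → LeftColumn ![c₀, c₁, c₂, c₃, c₄, c₅]) ∧
      ((c₁ ≠ c₀ ∨ c₅ ≠ c₄) → LeftRow ![c₀, c₁, c₂, c₃, c₄, c₅]) := by
  decide +kernel

lemma mem_of_abs_le_one {a : ℤ} (h : |a| ≤ 1) : a ∈ ([-1, 0, 1] : List ℤ) := by
  rw [abs_le] at h
  simp
  omega

lemma column_cases {m n : Type*} {T : Matrix m n ℤ} (hT : T.IsTotallyUnimodular)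
    {ρ : Fin 6 → m} {κ : Fin 6 → n} (h : ∀ i j, T (ρ i) (κ j) = signedD i j) (e : n) :
    ((T (ρ 2) e ≠ 0 ∨ T (ρ 3) e ≠ 0) → LeftColumn fun i ↦ T (ρ i) e) ∧
    ((T (ρ 1) e ≠ T (ρ 0) e ∨ T (ρ 5) e ≠ T (ρ 4) e) → LeftRow fun i ↦ T (ρ i) e) := by
  have h1 : (fun i ↦ T (ρ i) e) = ![T (ρ 0) e, T (ρ 1) e, T (ρ 2) e, T (ρ 3) e, T (ρ 4) e,
      T (ρ 5) e] := by
    ext i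
    fin_cases i <;> rfl
  rw [h1]
  have hm := fun i ↦ mem_of_abs_le_one (hT.abs_le_one (ρ i) e)
  exact columnConstraints_cases _ (hm 0) _ (hm 1) _ (hm 2) _ (hm 3) _ (hm 4) _ (hm 5)
    (columnConstraints hT h e)

lemma leftColumn_of_ne_zero {m n : Type*} {T : Matrix m n ℤ} (hT : T.IsTotallyUnimodular)
    {ρ : Fin 6 → m} {κ : Fin 6 → n} (h : ∀ i j, T (ρ i) (κ j) = signedD i j) {e : n}
    (he : T (ρ 2) e ≠ 0 ∨ T (ρ 3) e ≠ 0) : LeftColumn fun i ↦ T (ρ i) e :=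
  (column_cases hT h e).1 he

lemma leftRow_of_ne {m n : Type*} {T : Matrix m n ℤ} (hT : T.IsTotallyUnimodular)
    {ρ : Fin 6 → m} {κ : Fin 6 → n} (h : ∀ i j, T (ρ i) (κ j) = signedD i j) {g : m}
    (hg : T g (κ 1) ≠ T g (κ 0) ∨ T g (κ 5) ≠ T g (κ 4)) : LeftRow fun j ↦ T g (κ j) := by
  refine (column_cases (T := Tᵀ) hT.transpose (ρ := κ) (κ := ρ) (fun i j ↦ ?_) g).2 hg
  rw [transpose_apply, h, ← signedD_transpose, transpose_apply, signedD_transpose]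

/-- A row compatible with both sides of `R₁₂` has a zero entry in the non-parallel column, unless it
vanishes on `R₁₂`. -/
lemma row_eq_zero_of_entry_ne_zero {m n : Type*} {T : Matrix m n ℤ} (hT : T.IsTotallyUnimodular)
    {ρ : Fin 6 → m} {κ : Fin 6 → n} (h : ∀ i j, T (ρ i) (κ j) = signedD i j) {e : n} {g : m}
    {s : ℤ} (hs : s = 1 ∨ s = -1) (he : ∀ i, T (ρ i) e = s * ![0, 0, 1, -1, 0, 0] i)
    (h1 : T g (κ 1) = T g (κ 0)) (h5 : T g (κ 5) = T g (κ 4)) (hge : T g e ≠ 0) (j : Fin 6) :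
    T g (κ j) = 0 := by
  have two := fun a x ↦ hT.abs_det_two_le (ρ a) g (κ x) e
  have three := fun a b x y ↦ hT.abs_det_three_le (ρ a) (ρ b) g (κ x) (κ y) e
  simp only [h, he] at two three
  have a1 := two 2 0
  have a2 := two 3 1
  have a3 := two 2 4
  have a4 := two 3 5
  have b1 := three 0 2 0 2
  have b2 := three 0 3 1 2
  have b3 := three 1 2 0 3
  have b4 := three 1 3 1 3
  have hx := hT.abs_le_one g e
  have hj := fun j ↦ hT.abs_le_one g (κ j)
  have q0 := hj 0
  have q2 := hj 2
  have q3 := hj 3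
  have q4 := hj 4
  simp [signedD] at a1 a2 a3 a4 b1 b2 b3 b4
  have hx' : T g e = 1 ∨ T g e = -1 := by
    rw [abs_le] at hx
    omega
  simp only [abs_le] at *
  have : T g (κ 0) = 0 ∧ T g (κ 4) = 0 := by
    rcases hs with rfl | rfl <;> rcases hx' with hx' | hx' <;> rw [hx'] at a1 a2 a3 a4 <;> omega
  have h0 := this.1
  have h4 := this.2
  have : T g (κ 2) = 0 ∧ T g (κ 3) = 0 := by
    rcases hs with rfl | rfl <;> rcases hx' with hx' | hx' <;> rw [hx'] at b1 b2 b3 b4 <;> omega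
  have h2 := this.1
  have h3 := this.2
  fin_cases j <;> simp [*]

lemma eq_one_or_neg_one {a : ℤ} (h : |a| ≤ 1) (h0 : a ≠ 0) : a = 1 ∨ a = -1 := by
  rw [abs_le] at h
  omega

/-- A totally unimodular matrix with the support of `signedD` is obtained from `signedD` by changing
the signs of rows and columns. -/
lemma exists_signs {A : Matrix (Fin 6) (Fin 6) ℤ} (hA : A.IsTotallyUnimodular)
    (hsupp : ∀ i j, A i j ≠ 0 ↔ signedD i j ≠ 0) :
    ∃ s t : Fin 6 → ℤ, (∀ i, s i = 1 ∨ s i = -1) ∧ (∀ j, t j = 1 ∨ t j = -1) ∧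
      ∀ i j, A i j = s i * t j * signedD i j := by
  have hu : ∀ i j, signedD i j ≠ 0 → A i j = 1 ∨ A i j = -1 := fun i j hij ↦
    eq_one_or_neg_one (hA.abs_le_one i j) ((hsupp i j).2 hij)
  have mul_sign : ∀ {a b : ℤ}, (a = 1 ∨ a = -1) → (b = 1 ∨ b = -1) → a * b = 1 ∨ a * b = -1 := by
    rintro a b (rfl | rfl) (rfl | rfl) <;> simp
  have sq : ∀ {a : ℤ}, (a = 1 ∨ a = -1) → a * a = 1 := by
    rintro a (rfl | rfl) <;> rfl
  have u00 := hu 0 0 (by decide)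
  have u01 := hu 0 1 (by decide)
  have u02 := hu 0 2 (by decide)
  have u10 := hu 1 0 (by decide)
  have u13 := hu 1 3 (by decide)
  have u20 := hu 2 0 (by decide)
  have u24 := hu 2 4 (by decide)
  have u31 := hu 3 1 (by decide)
  have u35 := hu 3 5 (by decide)
  have u42 := hu 4 2 (by decide)
  have u53 := hu 5 3 (by decide)
  -- The eleven entries used here form a spanning tree of the bipartite graph of the support on 6 +
  -- 6 vertices, so scaling can turn all of them into 1.
  obtain ⟨t0, ht0⟩ : ∃ x, x = A 0 0 := ⟨_, rfl⟩
  obtain ⟨t1, ht1⟩ : ∃ x, x = A 0 1 := ⟨_, rfl⟩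
  obtain ⟨t2, ht2⟩ : ∃ x, x = A 0 2 := ⟨_, rfl⟩
  obtain ⟨s1, hs1⟩ : ∃ x, x = A 1 0 * t0 := ⟨_, rfl⟩
  obtain ⟨s2, hs2⟩ : ∃ x, x = A 2 0 * t0 := ⟨_, rfl⟩
  obtain ⟨s3, hs3⟩ : ∃ x, x = A 3 1 * t1 := ⟨_, rfl⟩
  obtain ⟨s4, hs4⟩ : ∃ x, x = A 4 2 * t2 := ⟨_, rfl⟩
  obtain ⟨t3, ht3⟩ : ∃ x, x = A 1 3 * s1 := ⟨_, rfl⟩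
  obtain ⟨t4, ht4⟩ : ∃ x, x = A 2 4 * s2 := ⟨_, rfl⟩
  obtain ⟨t5, ht5⟩ : ∃ x, x = A 3 5 * s3 := ⟨_, rfl⟩
  obtain ⟨s5, hs5⟩ : ∃ x, x = A 5 3 * t3 := ⟨_, rfl⟩
  have vt0 : t0 = 1 ∨ t0 = -1 := ht0 ▸ u00
  have vt1 : t1 = 1 ∨ t1 = -1 := ht1 ▸ u01
  have vt2 : t2 = 1 ∨ t2 = -1 := ht2 ▸ u02
  have vs1 : s1 = 1 ∨ s1 = -1 := hs1 ▸ mul_sign u10 vt0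
  have vs2 : s2 = 1 ∨ s2 = -1 := hs2 ▸ mul_sign u20 vt0
  have vs3 : s3 = 1 ∨ s3 = -1 := hs3 ▸ mul_sign u31 vt1
  have vs4 : s4 = 1 ∨ s4 = -1 := hs4 ▸ mul_sign u42 vt2
  have vt3 : t3 = 1 ∨ t3 = -1 := ht3 ▸ mul_sign u13 vs1
  have vt4 : t4 = 1 ∨ t4 = -1 := ht4 ▸ mul_sign u24 vs2
  have vt5 : t5 = 1 ∨ t5 = -1 := ht5 ▸ mul_sign u35 vs3
  have vs5 : s5 = 1 ∨ s5 = -1 := hs5 ▸ mul_sign u53 vt3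
  have vs : ∀ i, ![1, s1, s2, s3, s4, s5] i = 1 ∨ ![1, s1, s2, s3, s4, s5] i = -1 := by
    intro i
    fin_cases i <;> simp [vs1, vs2, vs3, vs4, vs5]
  have vt : ∀ i, ![t0, t1, t2, t3, t4, t5] i = 1 ∨ ![t0, t1, t2, t3, t4, t5] i = -1 := by
    intro i
    fin_cases i <;> simp [vt0, vt1, vt2, vt3, vt4, vt5]
  refine ⟨![1, s1, s2, s3, s4, s5], ![t0, t1, t2, t3, t4, t5], vs, vt, ?_⟩
  have hsign : ∀ {a : ℤ}, (a = 1 ∨ a = -1) → a ∈ Set.range (SignType.cast : SignType → ℤ) := by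
    rintro a (rfl | rfl)
    exacts [⟨1, by simp⟩, ⟨-1, by simp⟩]
  have hB := hA.scale (fun i ↦ hsign (vs i)) (fun i ↦ hsign (vt i))
  generalize hBdef : (Matrix.of fun i j ↦ ![1, s1, s2, s3, s4, s5] i *
    ![t0, t1, t2, t3, t4, t5] j * A i j) = B at hB
  have hBA : ∀ i j, B i j = ![1, s1, s2, s3, s4, s5] i * ![t0, t1, t2, t3, t4, t5] j * A i j := by
    intro i j
    rw [← hBdef]
    rfl
  have hAB : ∀ i j, A i j = ![1, s1, s2, s3, s4, s5] i * ![t0, t1, t2, t3, t4, t5] j * B i j := by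
    intro i j
    rw [hBA]
    linear_combination (-A i j * (![t0, t1, t2, t3, t4, t5] j * ![t0, t1, t2, t3, t4, t5] j)) *
      sq (vs i) - A i j * sq (vt j)
  suffices h : ∀ i j, B i j = signedD i j by
    intro i j
    rw [hAB, h]
  have z : ∀ i j, signedD i j = 0 → B i j = 0 := by
    intro i j hij
    have : A i j = 0 := by
      by_contra hne
      exact (hsupp i j).1 hne hij
    rw [hBA, this, mul_zero]
  have nz : ∀ i j, signedD i j ≠ 0 → B i j ≠ 0 := by
    intro i j hij h0
    exact (hsupp i j).2 hij (by rw [hAB, h0, mul_zero])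
  have b00 : B 0 0 = 1 := by rw [hBA]; simp; rw [← ht0, sq vt0]
  have b01 : B 0 1 = 1 := by rw [hBA]; simp; rw [← ht1, sq vt1]
  have b02 : B 0 2 = 1 := by rw [hBA]; simp; rw [← ht2, sq vt2]
  have b10 : B 1 0 = 1 := by
    rw [hBA]; simp; rw [mul_assoc, mul_comm t0, ← hs1, sq vs1]
  have b20 : B 2 0 = 1 := by
    rw [hBA]; simp; rw [mul_assoc, mul_comm t0, ← hs2, sq vs2]
  have b31 : B 3 1 = 1 := by
    rw [hBA]; simp; rw [mul_assoc, mul_comm t1, ← hs3, sq vs3]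
  have b42 : B 4 2 = 1 := by
    rw [hBA]; simp; rw [mul_assoc, mul_comm t2, ← hs4, sq vs4]
  have b13 : B 1 3 = 1 := by
    rw [hBA]; simp; rw [mul_comm s1, mul_assoc, mul_comm s1, ← ht3, sq vt3]
  have b24 : B 2 4 = 1 := by
    rw [hBA]; simp; rw [mul_comm s2, mul_assoc, mul_comm s2, ← ht4, sq vt4]
  have b35 : B 3 5 = 1 := by
    rw [hBA]; simp; rw [mul_comm s3, mul_assoc, mul_comm s3, ← ht5, sq vt5]
  have b53 : B 5 3 = 1 := by
    rw [hBA]; simp; rw [mul_assoc, mul_comm t3, ← hs5, sq vs5]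
  -- Five nonzero entries lie off the tree. Each closes a cycle, and the wrong sign would give the
  -- corresponding minor absolute value 2.
  have c1 := hB.abs_det_two_le 0 1 0 1
  have c2 := hB.abs_det_two_le 4 5 4 5
  have c3 := hB.abs_det_three_le 0 2 4 0 2 4
  have c4 := hB.abs_det_three_le 0 3 4 1 2 5
  have c5 := hB.abs_det_three_le 1 2 5 0 3 4
  have n11 := eq_one_or_neg_one (hB.abs_le_one 1 1) (nz 1 1 (by decide))
  have n44 := eq_one_or_neg_one (hB.abs_le_one 4 4) (nz 4 4 (by decide))
  have n45 := eq_one_or_neg_one (hB.abs_le_one 4 5) (nz 4 5 (by decide))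
  have n54 := eq_one_or_neg_one (hB.abs_le_one 5 4) (nz 5 4 (by decide))
  have n55 := eq_one_or_neg_one (hB.abs_le_one 5 5) (nz 5 5 (by decide))
  simp only [b00, b01, b10, b20, b02, b42, b24, b31, b35, b13, b53, z 0 4 (by decide),
    z 2 2 (by decide), z 4 0 (by decide), z 0 5 (by decide), z 3 2 (by decide), z 4 1 (by decide),
    z 1 4 (by decide), z 2 3 (by decide), z 5 0 (by decide), abs_le] at c1 c2 c3 c4 c5
  have e11 : B 1 1 = 1 := by omega
  have e44 : B 4 4 = -1 := by omega
  have e45 : B 4 5 = -1 := by omega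
  have e54 : B 5 4 = -1 := by omega
  have e55 : B 5 5 = -1 := by
    rw [e44, e45, e54] at c2
    omega
  intro i j
  by_cases hij : signedD i j = 0
  · rw [z i j hij, hij]
  · fin_cases i <;> fin_cases j <;> first | exact absurd rfl hij | assumption

end Matroid

/-! ### Forcing in a matrix that contains an R₁₂ block. -/

namespace Matroid

open Matrix

variable {m n : Type*}

/-- `P` is totally unimodular, and its rows `ρ i` and columns `κ j` form `signedD` up to signs: the
matroid represented by `[I | P]` has a minor `R₁₂` on these rows and columns. -/
structure HasR12Block (P : Matrix m n ℤ) (ρ : Fin 6 → m) (κ : Fin 6 → n) : Prop where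
  tu : P.IsTotallyUnimodular
  signs : ∃ s t : Fin 6 → ℤ, (∀ i, s i = 1 ∨ s i = -1) ∧ (∀ j, t j = 1 ∨ t j = -1) ∧
      ∀ i j, P (ρ i) (κ j) = s i * t j * signedD i j

/-- The deviation of the entry `P f v` from the value that it has when row `f` is on the right and
column `v` on the left side of a 3-separation extending that of `R₁₂`. -/
def deviation (P : Matrix m n ℤ) (ρ : Fin 6 → m) (κ : Fin 6 → n) (f : m) (v : n) : ℤ :=
  P f v - P f (κ 0) * P (ρ 0) (κ 0) * P (ρ 0) v - P f (κ 4) * P (ρ 4) (κ 4) * P (ρ 4) v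

/-- The left elements of the copy of `R₁₂`. -/
def Left (ρ : Fin 6 → m) (κ : Fin 6 → n) : m ⊕ n → Prop
  | .inl f => ∃ k ∈ ([2, 3] : List (Fin 6)), f = ρ k
  | .inr v => ∃ a ∈ ([0, 1, 4, 5] : List (Fin 6)), v = κ a

/-- The right elements of the copy of `R₁₂`. -/
def Right (ρ : Fin 6 → m) (κ : Fin 6 → n) : m ⊕ n → Prop
  | .inl f => ∃ k ∈ ([0, 1, 4, 5] : List (Fin 6)), f = ρ k
  | .inr v => ∃ a ∈ ([2, 3] : List (Fin 6)), v = κ a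

/-- `Forces P ρ κ x y`: if `x` is on the left side of a 3-separation extending that of `R₁₂`, then so
is `y`. -/
def Forces (P : Matrix m n ℤ) (ρ : Fin 6 → m) (κ : Fin 6 → n) : m ⊕ n → m ⊕ n → Prop
  | .inl f, .inr v => P f v ≠ 0
  | .inr v, .inl f => deviation P ρ κ f v ≠ 0
  | _, _ => False

/-- `ForcesRight P ρ κ k x`: a chain of `k` forcing steps leads from `x` to a right element. -/
def ForcesRight (P : Matrix m n ℤ) (ρ : Fin 6 → m) (κ : Fin 6 → n) : ℕ → m ⊕ n → Prop
  | 0, x => Right ρ κ x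
  | k + 1, x => ∃ y, Forces P ρ κ x y ∧ ForcesRight P ρ κ k y

/-- Used to carry the tail of a chain over to a modified matrix or block. The bound `K` allows
minimality of the chain to be invoked when checking that each step survives. -/
lemma ForcesRight.transfer {P P' : Matrix m n ℤ} {ρ ρ' : Fin 6 → m} {κ κ' : Fin 6 → n} {K : ℕ}
    (hR : ∀ x, Right ρ κ x → Right ρ' κ' x)
    (hrow : ∀ f v k, k < K → ForcesRight P ρ κ k (.inr v) → P f v ≠ 0 → P' f v ≠ 0)
    (hcol : ∀ f v k, k < K → ForcesRight P ρ κ k (.inl f) → deviation P ρ κ f v ≠ 0 →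
      deviation P' ρ' κ' f v ≠ 0) :
    ∀ (k : ℕ) (x : m ⊕ n), k ≤ K → ForcesRight P ρ κ k x → ForcesRight P' ρ' κ' k x
  | 0, x, _, h => hR x h
  | k + 1, x, hk, ⟨y, hxy, hy⟩ => by
    refine ⟨y, ?_, ForcesRight.transfer hR hrow hcol k y (by omega) hy⟩
    match x, y with
    | .inl f, .inr v => exact hrow f v k (by omega) hy hxy
    | .inr v, .inl f => exact hcol f v k (by omega) hy hxy

lemma sign_mul_self {a : ℤ} (h : a = 1 ∨ a = -1) : a * a = 1 := by
  rcases h with rfl | rfl <;> rfl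

lemma sign_ne_zero {a : ℤ} (h : a = 1 ∨ a = -1) : a ≠ 0 := by
  rcases h with rfl | rfl <;> decide

lemma sign_mul {a b : ℤ} (ha : a = 1 ∨ a = -1) (hb : b = 1 ∨ b = -1) :
    a * b = 1 ∨ a * b = -1 := by
  rcases ha with rfl | rfl <;> rcases hb with rfl | rfl <;> simp

lemma sign_mem_range {a : ℤ} (h : a = 1 ∨ a = -1) :
    a ∈ Set.range (SignType.cast : SignType → ℤ) := by
  rcases h with rfl | rfl
  exacts [⟨1, by simp⟩, ⟨-1, by simp⟩]

namespace HasR12Block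

variable {P : Matrix m n ℤ} {ρ : Fin 6 → m} {κ : Fin 6 → n}

lemma ne_zero_iff (h : HasR12Block P ρ κ) (i j : Fin 6) :
    P (ρ i) (κ j) ≠ 0 ↔ signedD i j ≠ 0 := by
  obtain ⟨s, t, hs, ht, hst⟩ := h.signs
  rw [hst, mul_ne_zero_iff, mul_ne_zero_iff]
  simp [sign_ne_zero (hs i), sign_ne_zero (ht j)]

lemma eq_zero (h : HasR12Block P ρ κ) {i j : Fin 6} (hij : signedD i j = 0) :
    P (ρ i) (κ j) = 0 := by
  by_contra hne
  exact (h.ne_zero_iff i j).1 hne hij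

lemma injective_left (h : HasR12Block P ρ κ) : ρ.Injective := by
  have key : ∀ i i', (∀ j, signedDᵀ j i ≠ 0 ↔ signedDᵀ j i' ≠ 0) → i = i' := by decide
  intro i i' hi
  refine key i i' fun j ↦ ?_
  rw [transpose_apply, transpose_apply]
  rw [← h.ne_zero_iff, ← h.ne_zero_iff, hi]

lemma injective_right (h : HasR12Block P ρ κ) : κ.Injective := by
  have key : ∀ i i', (∀ j, signedD j i ≠ 0 ↔ signedD j i' ≠ 0) → i = i' := by decide
  intro i i' hi
  refine key i i' fun j ↦ ?_
  rw [← h.ne_zero_iff, ← h.ne_zero_iff, hi]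

lemma mul_self (h : HasR12Block P ρ κ) (i j : Fin 6) (hij : signedD i j ≠ 0) :
    P (ρ i) (κ j) * P (ρ i) (κ j) = 1 :=
  sign_mul_self (eq_one_or_neg_one (h.tu.abs_le_one _ _) ((h.ne_zero_iff i j).2 hij))

/-- Rescaling gives a totally unimodular matrix that contains `signedD` exactly. -/
lemma exists_scaled (h : HasR12Block P ρ κ) {s t : Fin 6 → ℤ} (hs : ∀ i, s i = 1 ∨ s i = -1)
    (ht : ∀ j, t j = 1 ∨ t j = -1) (hst : ∀ i j, P (ρ i) (κ j) = s i * t j * signedD i j)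
    (g : m) (e : n) :
    ∃ T : Matrix (Fin 6 ⊕ Unit) (Fin 6 ⊕ Unit) ℤ, T.IsTotallyUnimodular ∧
      (∀ i j, T (.inl i) (.inl j) = signedD i j) ∧
      (∀ i, P (ρ i) e = s i * T (.inl i) (.inr ())) ∧
      (∀ j, P g (κ j) = t j * T (.inr ()) (.inl j)) ∧ P g e = T (.inr ()) (.inr ()) := by
  refine ⟨_, (h.tu.submatrix (Sum.elim ρ fun _ : Unit ↦ g)
    (Sum.elim κ fun _ : Unit ↦ e)).scale (s := Sum.elim s 1) (t := Sum.elim t 1) ?_ ?_, ?_, ?_, ?_,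
    ?_⟩
  · rintro (i | i)
    exacts [sign_mem_range (hs i), ⟨1, by simp⟩]
  · rintro (i | i)
    exacts [sign_mem_range (ht i), ⟨1, by simp⟩]
  · intro i j
    simp only [of_apply, submatrix_apply, Sum.elim_inl, hst]
    linear_combination (t j * t j * signedD i j) * sign_mul_self (hs i) +
      signedD i j * sign_mul_self (ht j)
  · intro i
    simp only [of_apply, submatrix_apply, Sum.elim_inl, Sum.elim_inr, Pi.one_apply]
    linear_combination (-P (ρ i) e) * sign_mul_self (hs i)
  · intro i
    simp only [of_apply, submatrix_apply, Sum.elim_inl, Sum.elim_inr, Pi.one_apply]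
    linear_combination (-P g (κ i)) * sign_mul_self (ht i)
  · simp

lemma deviation_zero (h : HasR12Block P ρ κ) (f : m) : deviation P ρ κ f (κ 0) = 0 := by
  rw [deviation, h.eq_zero (i := 4) (j := 0) (by decide)]
  linear_combination (-P f (κ 0)) * h.mul_self 0 0 (by decide)

lemma deviation_four (h : HasR12Block P ρ κ) (f : m) : deviation P ρ κ f (κ 4) = 0 := by
  rw [deviation, h.eq_zero (i := 0) (j := 4) (by decide)]
  linear_combination (-P f (κ 4)) * h.mul_self 4 4 (by decide)

/-- In the reference columns 0 and 4, row 1 of `signedD` agrees with row 0, and row 5 with row 4. So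
for these rows the deviation is a plain difference. -/
lemma deviation_eq_of_column {s t : Fin 6 → ℤ} {c : Fin 6 → ℤ} {e : n}
    (hs : ∀ i, s i = 1 ∨ s i = -1) (ht : ∀ j, t j = 1 ∨ t j = -1)
    (hst : ∀ i j, P (ρ i) (κ j) = s i * t j * signedD i j) (hc : ∀ i, P (ρ i) e = s i * c i) :
    deviation P ρ κ (ρ 1) e = s 1 * (c 1 - c 0) ∧
      deviation P ρ κ (ρ 5) e = s 5 * (c 5 - c 4) := by
  have s2 := fun i ↦ sign_mul_self (hs i)
  have t2 := fun i ↦ sign_mul_self (ht i)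
  constructor
  · rw [deviation]
    simp only [hc, hst, show signedD 1 0 = 1 from rfl, show signedD 0 0 = 1 from rfl,
      show signedD 1 4 = 0 from rfl]
    linear_combination (-s 1 * c 0 * t 0 * t 0) * s2 0 - s 1 * c 0 * t2 0
  · rw [deviation]
    simp only [hc, hst, show signedD 5 4 = -1 from rfl, show signedD 4 4 = -1 from rfl,
      show signedD 5 0 = 0 from rfl]
    linear_combination (-s 5 * c 4 * t 4 * t 4) * s2 4 - s 5 * c 4 * t2 4

lemma deviation_eq_of_row {s t : Fin 6 → ℤ} {r : Fin 6 → ℤ} {g : m}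
    (hs : ∀ i, s i = 1 ∨ s i = -1) (ht : ∀ j, t j = 1 ∨ t j = -1)
    (hst : ∀ i j, P (ρ i) (κ j) = s i * t j * signedD i j) (hr : ∀ j, P g (κ j) = t j * r j) :
    deviation P ρ κ g (κ 1) = t 1 * (r 1 - r 0) ∧
      deviation P ρ κ g (κ 5) = t 5 * (r 5 - r 4) := by
  have s2 := fun i ↦ sign_mul_self (hs i)
  have t2 := fun i ↦ sign_mul_self (ht i)
  constructor
  · rw [deviation]
    simp only [hr, hst, show signedD 0 1 = 1 from rfl, show signedD 0 0 = 1 from rfl,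
      show signedD 4 1 = 0 from rfl]
    linear_combination (-t 1 * r 0 * s 0 * s 0) * t2 0 - t 1 * r 0 * s2 0
  · rw [deviation]
    simp only [hr, hst, show signedD 4 5 = -1 from rfl, show signedD 4 4 = -1 from rfl,
      show signedD 0 5 = 0 from rfl]
    linear_combination (-t 5 * r 4 * s 4 * s 4) * t2 4 - t 5 * r 4 * s2 4

/-- A column forced to the left by `R₁₂` does not force `R₁₂`, and its restriction is known. -/
lemma column_cases (h : HasR12Block P ρ κ) {e : n} (he : P (ρ 2) e ≠ 0 ∨ P (ρ 3) e ≠ 0) :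
    (deviation P ρ κ (ρ 1) e = 0 ∧ deviation P ρ κ (ρ 5) e = 0) ∧
    ((∃ k ∈ ([2, 3] : List (Fin 6)), ∀ i, P (ρ i) e ≠ 0 ↔ i = k) ∨
    (∃ a ∈ ([0, 1, 4, 5] : List (Fin 6)), ∃ r : ℤ, (r = 1 ∨ r = -1) ∧
      ∀ i, P (ρ i) e = r * P (ρ i) (κ a)) ∨
    (P (ρ 0) e = 0 ∧ P (ρ 2) e ≠ 0 ∧ P (ρ 4) e = 0 ∧
      ∀ g, deviation P ρ κ g (κ 1) = 0 → deviation P ρ κ g (κ 5) = 0 → P g e ≠ 0 →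
        ∀ j, P g (κ j) = 0)) := by
  obtain ⟨s, t, hs, ht, hst⟩ := h.signs
  -- Only the adjoined column matters here; `ρ 0` merely fills the place of the adjoined row.
  obtain ⟨T, hT, hD, hc, hr, hge⟩ := h.exists_scaled hs ht hst (ρ 0) e
  obtain ⟨h1, h5, x, hx, hcases⟩ := leftColumn_of_ne_zero hT (ρ := .inl) (κ := .inl) hD
    (e := .inr ()) (by
      rw [hc, hc] at he
      exact he.imp right_ne_zero_of_mul right_ne_zero_of_mul)
  obtain ⟨d1, d5⟩ := deviation_eq_of_column hs ht hst hc
  beta_reduce at h1 h5 hcases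
  have hx' : x = 1 ∨ x = -1 := by simpa using hx
  refine ⟨by rw [d1, d5, h1, h5]; simp, ?_⟩
  rcases hcases with ⟨k, hk, hi⟩ | ⟨a, ha, hi⟩ | hi
  · refine .inl ⟨k, hk, fun i ↦ ?_⟩
    rw [hc, hi]
    by_cases hik : i = k <;> simp [hik, sign_ne_zero (hs k), sign_ne_zero hx']
  · refine .inr (.inl ⟨a, ha, x * t a, sign_mul hx' (ht a), fun i ↦ ?_⟩)
    rw [hc, hi, hst]
    linear_combination (-s i * x * signedD i a) * sign_mul_self (ht a)
  · refine .inr (.inr ⟨?_, ?_, ?_, fun g hg1 hg5 hge j ↦ ?_⟩)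
    · rw [hc, hi]
      simp
    · rw [hc, hi]
      simp [sign_ne_zero hx', sign_ne_zero (hs 2)]
    · rw [hc, hi]
      simp
    · obtain ⟨T', hT', hD', hc', hr', hge'⟩ := h.exists_scaled hs ht hst g e
      obtain ⟨e1, e5⟩ := deviation_eq_of_row hs ht hst hr'
      rw [e1, mul_eq_zero_iff_left (sign_ne_zero (ht 1)), sub_eq_zero] at hg1
      rw [e5, mul_eq_zero_iff_left (sign_ne_zero (ht 5)), sub_eq_zero] at hg5
      rw [hr', row_eq_zero_of_entry_ne_zero hT' (ρ := .inl) (κ := .inl) hD' hx' (e := .inr ())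
        (fun i ↦ ?_) hg1 hg5 (hge' ▸ hge) j, mul_zero]
      rw [← hi]
      exact mul_left_cancel₀ (sign_ne_zero (hs i)) ((hc' i).symm.trans (hc i))

/-- A row forced to the left by `R₁₂` does not force `R₁₂`, and its restriction is known. -/
lemma row_cases (h : HasR12Block P ρ κ) {g : m}
    (hg : deviation P ρ κ g (κ 1) ≠ 0 ∨ deviation P ρ κ g (κ 5) ≠ 0) :
    (P g (κ 2) = 0 ∧ P g (κ 3) = 0) ∧
    ((∃ a ∈ ([0, 1, 4, 5] : List (Fin 6)), ∀ j, P g (κ j) ≠ 0 ↔ j = a) ∨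
    (∃ k ∈ ([2, 3] : List (Fin 6)), ∃ r : ℤ, (r = 1 ∨ r = -1) ∧
      ∀ j, P g (κ j) = r * P (ρ k) (κ j))) := by
  obtain ⟨s, t, hs, ht, hst⟩ := h.signs
  obtain ⟨T, hT, hD, hc, hr, hge⟩ := h.exists_scaled hs ht hst g (κ 0)
  obtain ⟨e1, e5⟩ := deviation_eq_of_row hs ht hst hr
  have hleft := leftRow_of_ne hT (ρ := .inl) (κ := .inl) hD (g := .inr ()) (by
    rw [e1, e5] at hg
    exact hg.imp (fun h ↦ sub_ne_zero.1 (right_ne_zero_of_mul h))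
      (fun h ↦ sub_ne_zero.1 (right_ne_zero_of_mul h)))
  obtain ⟨h2, h3, x, hx, hcases⟩ := hleft
  beta_reduce at h2 h3 hcases
  have hx' : x = 1 ∨ x = -1 := by simpa using hx
  refine ⟨by rw [hr, hr, h2, h3]; simp, ?_⟩
  rcases hcases with ⟨k, hk, hi⟩ | ⟨a, ha, hi⟩
  · refine .inl ⟨k, hk, fun i ↦ ?_⟩
    rw [hr, hi]
    by_cases hik : i = k <;> simp [hik, sign_ne_zero (ht k), sign_ne_zero hx']
  · refine .inr ⟨a, ha, x * s a, sign_mul hx' (hs a), fun i ↦ ?_⟩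
    rw [hr, hi, hst]
    linear_combination (-t i * x * signedD a i) * sign_mul_self (hs a)

end HasR12Block

end Matroid

/-! ### Shortening a chain from left to right. -/

namespace Matroid

open Matrix

variable {m n : Type*}

namespace HasR12Block

variable {P : Matrix m n ℤ} {ρ : Fin 6 → m} {κ : Fin 6 → n}

lemma entry_mul_self (h : HasR12Block P ρ κ) {f : m} {v : n} (hfv : P f v ≠ 0) :
    P f v * P f v = 1 :=
  sign_mul_self (eq_one_or_neg_one (h.tu.abs_le_one _ _) hfv)

lemma not_right_of_left (h : HasR12Block P ρ κ) {x : m ⊕ n} (hx : Left ρ κ x) :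
    ¬ Right ρ κ x := by
  have key : ∀ k ∈ ([2, 3] : List (Fin 6)), ∀ a ∈ ([0, 1, 4, 5] : List (Fin 6)), k ≠ a := by decide
  rintro hx'
  match x, hx, hx' with
  | .inl f, ⟨k, hk, hfk⟩, ⟨a, ha, hfa⟩ => exact key k hk a ha (h.injective_left (hfk ▸ hfa))
  | .inr v, ⟨a, ha, hfa⟩, ⟨k, hk, hfk⟩ => exact key k hk a ha (h.injective_right (hfk ▸ hfa))

/-- The partition of R₁₂ itself satisfies both block conditions, which rules out chains with one
step. -/
lemma not_forces (h : HasR12Block P ρ κ) {x y : m ⊕ n} (hx : Left ρ κ x) (hy : Right ρ κ y) :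
    ¬ Forces P ρ κ x y := by
  intro hxy
  match x, y, hx, hy, hxy with
  | .inl f, .inr v, ⟨k, hk, hf⟩, ⟨a, ha, hv⟩, hxy =>
    subst hf hv
    have key : ∀ a ∈ ([2, 3] : List (Fin 6)), ∀ k ∈ ([2, 3] : List (Fin 6)), signedD k a = 0 := by
      decide
    exact hxy (h.eq_zero (key a ha k hk))
  | .inr v, .inl f, ⟨a, ha, hv⟩, ⟨k, hk, hf⟩, hxy =>
    subst hf hv
    apply hxy
    obtain ⟨s, t, hs, ht, hst⟩ := h.signs
    have key : ∀ k ∈ ([0, 1, 4, 5] : List (Fin 6)), ∀ a ∈ ([0, 1, 4, 5] : List (Fin 6)),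
      signedD k a - signedD k 0 * signedD 0 0 * signedD 0 a -
        signedD k 4 * signedD 4 4 * signedD 4 a = 0 := by decide
    rw [deviation]
    simp only [hst]
    linear_combination (s k * t a) * key k hk a ha
      - s k * t a * (t 0 * t 0) * signedD k 0 * signedD 0 0 * signedD 0 a * sign_mul_self (hs 0)
      - s k * t a * signedD k 0 * signedD 0 0 * signedD 0 a * sign_mul_self (ht 0)
      - s k * t a * (t 4 * t 4) * signedD k 4 * signedD 4 4 * signedD 4 a * sign_mul_self (hs 4)
      - s k * t a * signedD k 4 * signedD 4 4 * signedD 4 a * sign_mul_self (ht 4)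

/-- Pivoting in a column that vanishes in the rows `ρ 0` and `ρ 4`. -/
lemma deviation_rowPivot [DecidableEq m] {g : m} {e : n} (h0 : P (ρ 0) e = 0) (h4 : P (ρ 4) e = 0)
    {f : m} (hf : f ≠ g) (v : n) :
    deviation (P.rowPivot g e) ρ κ f v =
      deviation P ρ κ f v - deviation P ρ κ f e * P g e * deviation P ρ κ g v := by
  have e0 : ∀ v, P.rowPivot g e (ρ 0) v = P (ρ 0) v := fun v ↦ rowPivot_of_eq_zero _ (by simp [h0])
  have e4 : ∀ v, P.rowPivot g e (ρ 4) v = P (ρ 4) v := fun v ↦ rowPivot_of_eq_zero _ (by simp [h4])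
  simp only [deviation, e0, e4, rowPivot_of_ne P hf, h0, h4]
  ring

/-- Pivoting in a column does not change the copy of `R₁₂` if it does not change the entries. -/
lemma rowPivot [DecidableEq m] (h : HasR12Block P ρ κ) {g : m} {e : n} (hge : P g e ≠ 0)
    (hz : ∀ i, ρ i ≠ g → ∀ j, P (ρ i) e * P g (κ j) = 0) :
    HasR12Block (P.rowPivot g e) ρ κ := by
  obtain ⟨s, t, hs, ht, hst⟩ := h.signs
  refine ⟨h.tu.rowPivot (h.entry_mul_self hge), s, t, hs, ht, fun i j ↦ ?_⟩
  rw [← hst]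
  by_cases hi : ρ i = g
  · simp [Matrix.rowPivot, hi]
  · exact rowPivot_of_eq_zero P (hz i hi j)

/-- The hypothesis that no chain from left to right that has fewer than `N` steps exists, for any
matrix with a copy of `R₁₂`. -/
def NoShortChain (m n : Type*) (N : ℕ) : Prop :=
  ∀ (P : Matrix m n ℤ) (ρ : Fin 6 → m) (κ : Fin 6 → n), HasR12Block P ρ κ →
    ∀ k x, k < N → Left ρ κ x → ¬ ForcesRight P ρ κ k x

section Chain

variable {N : ℕ} {x₀ : m ⊕ n}

lemma not_left_of_chain (h : HasR12Block P ρ κ) (hmin : NoShortChain m n N) {k : ℕ} (hk : k < N)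
    {y : m ⊕ n} (hy : ForcesRight P ρ κ k y) : ¬ Left ρ κ y :=
  fun hl ↦ hmin P ρ κ h k y hk hl hy

/-- A nonzero entry would let a left element of R₁₂ join the chain late and give a shorter one. Such
vanishing is what protects the tail of the chain when the matrix is pivoted. -/
lemma entry_eq_zero_of_chain (h : HasR12Block P ρ κ) (hmin : NoShortChain m n N) {k : ℕ}
    (hk : k + 1 < N) {v : n} (hy : ForcesRight P ρ κ k (.inr v)) {a : Fin 6}
    (ha : a ∈ ([2, 3] : List (Fin 6))) : P (ρ a) v = 0 := by
  by_contra hne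
  exact hmin P ρ κ h (k + 1) (.inl (ρ a)) hk ⟨a, ha, rfl⟩ ⟨.inr v, hne, hy⟩

lemma deviation_eq_zero_of_chain (h : HasR12Block P ρ κ) (hmin : NoShortChain m n N) {k : ℕ}
    (hk : k + 1 < N) {f : m} (hy : ForcesRight P ρ κ k (.inl f)) {a : Fin 6}
    (ha : a ∈ ([0, 1, 4, 5] : List (Fin 6))) : deviation P ρ κ f (κ a) = 0 := by
  by_contra hne
  exact hmin P ρ κ h (k + 1) (.inr (κ a)) hk ⟨a, ha, rfl⟩ ⟨.inl f, hne, hy⟩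

lemma not_forces_of_chain (h : HasR12Block P ρ κ) (hmin : NoShortChain m n N)
    (hx₀ : Left ρ κ x₀) {y z : m ⊕ n} (hy : Forces P ρ κ x₀ y) {k : ℕ} (hk : k + 2 < N)
    (hz : ForcesRight P ρ κ k z) : ¬ Forces P ρ κ y z :=
  fun hyz ↦ hmin P ρ κ h (k + 2) x₀ hk hx₀ ⟨y, hy, z, hyz, hz⟩

/-- The second element of a shortest chain is not a column in series with a row of `R₁₂`. -/
lemma false_of_unit_column (h : HasR12Block P ρ κ) (hmin : NoShortChain m n (N + 2))
    (hx₀ : Left ρ κ x₀) {e : n} {g : m} (he : Forces P ρ κ x₀ (.inr e))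
    (hge : Forces P ρ κ (.inr e) (.inl g)) (hg : ForcesRight P ρ κ N (.inl g)) {k : Fin 6}
    (hk : k ∈ ([2, 3] : List (Fin 6))) (hek : ∀ i, P (ρ i) e ≠ 0 ↔ i = k) : False := by
  classical
  have h0 : P (ρ 0) e = 0 := by
    by_contra hne
    rw [← (hek 0).1 hne] at hk
    simp at hk
  have h4 : P (ρ 4) e = 0 := by
    by_contra hne
    rw [← (hek 4).1 hne] at hk
    simp at hk
  have hke : P (ρ k) e ≠ 0 := (hek k).2 rfl
  -- After this pivot column `e` is a multiple of the unit vector at `ρ k`: the label `ρ k` now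
  -- stands for `e`, which has thereby replaced the old basis element in the copy of R₁₂.
  have h' : HasR12Block (P.rowPivot (ρ k) e) ρ κ := by
    refine h.rowPivot hke fun i hi j ↦ ?_
    have : P (ρ i) e = 0 := by
      by_contra hne
      exact hi (by rw [(hek i).1 hne])
    simp [this]
  have hgk : g ≠ ρ k := by
    rintro rfl
    exact h.not_left_of_chain hmin (by omega) hg ⟨k, hk, rfl⟩
  -- Column 1 serves for both values of `k`: rows 2 and 3 of `signedD` each take different values in
  -- columns 0 and 1.
  have hk1 : deviation P ρ κ (ρ k) (κ 1) ≠ 0 := by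
    obtain ⟨s, t, hs, ht, hst⟩ := h.signs
    rw [(deviation_eq_of_row hs ht hst (r := fun j ↦ s k * signedD k j)
      fun j ↦ by rw [hst]; ring).1]
    refine mul_ne_zero (sign_ne_zero (ht 1)) ?_
    rw [← mul_sub]
    refine mul_ne_zero (sign_ne_zero (hs k)) ?_
    simp only [List.mem_cons, List.not_mem_nil, or_false] at hk
    rcases hk with rfl | rfl <;> decide
  refine hmin _ ρ κ h' (N + 1) (.inr (κ 1)) (by omega) ⟨1, by simp, rfl⟩ ⟨.inl g, ?_, ?_⟩
  · change deviation _ ρ κ g (κ 1) ≠ 0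
    rw [deviation_rowPivot h0 h4 hgk, h.deviation_eq_zero_of_chain hmin (by omega) hg (by simp),
      zero_sub, neg_ne_zero]
    exact mul_ne_zero (mul_ne_zero hge hke) hk1
  · refine ForcesRight.transfer (K := N) (fun _ ↦ id) (fun f v j hj hv hfv ↦ ?_)
      (fun f v j hj hf hfv ↦ ?_) N _ le_rfl hg
    · rwa [rowPivot_of_eq_zero]
      rw [h.entry_eq_zero_of_chain hmin (by omega) hv hk, mul_zero]
    · have hfk : f ≠ ρ k := by
        rintro rfl
        exact h.not_left_of_chain hmin (by omega) hf ⟨k, hk, rfl⟩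
      have hfe : deviation P ρ κ f e = 0 := by
        by_contra hne
        exact h.not_forces_of_chain hmin hx₀ he (by omega) hf hne
      rwa [deviation_rowPivot h0 h4 hfk, hfe, zero_mul, zero_mul, sub_zero]

/-- Replacing a column of the copy of `R₁₂` by a parallel one. -/
lemma update_column (h : HasR12Block P ρ κ) {e : n} {a : Fin 6} {r : ℤ} (hr : r = 1 ∨ r = -1)
    (hea : ∀ i, P (ρ i) e = r * P (ρ i) (κ a)) :
    HasR12Block P ρ (Function.update κ a e) := by
  obtain ⟨s, t, hs, ht, hst⟩ := h.signs
  refine ⟨h.tu, s, Function.update t a (r * t a), hs, fun j ↦ ?_, fun i j ↦ ?_⟩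
  · by_cases hj : j = a
    · subst hj
      simpa using sign_mul hr (ht j)
    · simpa [hj] using ht j
  · by_cases hj : j = a
    · subst hj
      simp [hea, hst]
      ring
    · simp [hj, hst]

/-- Replacing a row of the copy of `R₁₂` by a series one. -/
lemma update_row (h : HasR12Block P ρ κ) {g : m} {k : Fin 6} {r : ℤ} (hr : r = 1 ∨ r = -1)
    (hgk : ∀ j, P g (κ j) = r * P (ρ k) (κ j)) :
    HasR12Block P (Function.update ρ k g) κ := by
  obtain ⟨s, t, hs, ht, hst⟩ := h.signs
  refine ⟨h.tu, Function.update s k (r * s k), t, fun j ↦ ?_, ht, fun i j ↦ ?_⟩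
  · by_cases hj : j = k
    · subst hj
      simpa using sign_mul hr (hs j)
    · simpa [hj] using hs j
  · by_cases hj : i = k
    · subst hj
      simp [hgk, hst]
      ring
    · simp [hj, hst]

lemma right_update_column {e : n} {a : Fin 6} (ha : a ∈ ([0, 1, 4, 5] : List (Fin 6)))
    {x : m ⊕ n} (hx : Right ρ κ x) : Right ρ (Function.update κ a e) x := by
  match x, hx with
  | .inl f, hx => exact hx
  | .inr v, ⟨b, hb, hv⟩ =>
    refine ⟨b, hb, ?_⟩
    have key : ∀ k ∈ ([2, 3] : List (Fin 6)), ∀ a ∈ ([0, 1, 4, 5] : List (Fin 6)), k ≠ a := by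
      decide
    rw [Function.update_of_ne (key b hb a ha), hv]

lemma right_update_row {g : m} {k : Fin 6} (hk : k ∈ ([2, 3] : List (Fin 6)))
    {x : m ⊕ n} (hx : Right ρ κ x) : Right (Function.update ρ k g) κ x := by
  match x, hx with
  | .inr v, hx => exact hx
  | .inl f, ⟨b, hb, hv⟩ =>
    refine ⟨b, hb, ?_⟩
    have key : ∀ k ∈ ([2, 3] : List (Fin 6)), ∀ a ∈ ([0, 1, 4, 5] : List (Fin 6)), a ≠ k := by
      decide
    rw [Function.update_of_ne (key k hk b hb), hv]

lemma deviation_update_zero (h : HasR12Block P ρ κ) {e : n} {r : ℤ} (hr : r = 1 ∨ r = -1)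
    (hea : ∀ i, P (ρ i) e = r * P (ρ i) (κ 0)) (f : m) (v : n) :
    deviation P ρ (Function.update κ 0 e) f v =
      deviation P ρ κ f v - r * deviation P ρ κ f e * P (ρ 0) (κ 0) * P (ρ 0) v := by
  simp only [deviation, Function.update_self, hea, h.eq_zero (i := 4) (j := 0) (by decide),
    Function.update_of_ne (show (4 : Fin 6) ≠ 0 by decide)]
  linear_combination P f (κ 0) * P (ρ 0) (κ 0) * P (ρ 0) v *
    ((-1 : ℤ) * sign_mul_self hr - r * r * (h.mul_self 0 0 (by decide)))

lemma deviation_update_four (h : HasR12Block P ρ κ) {e : n} {r : ℤ} (hr : r = 1 ∨ r = -1)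
    (hea : ∀ i, P (ρ i) e = r * P (ρ i) (κ 4)) (f : m) (v : n) :
    deviation P ρ (Function.update κ 4 e) f v =
      deviation P ρ κ f v - r * deviation P ρ κ f e * P (ρ 4) (κ 4) * P (ρ 4) v := by
  simp only [deviation, Function.update_self, hea, h.eq_zero (i := 0) (j := 4) (by decide),
    Function.update_of_ne (show (0 : Fin 6) ≠ 4 by decide)]
  linear_combination P f (κ 4) * P (ρ 4) (κ 4) * P (ρ 4) v *
    ((-1 : ℤ) * sign_mul_self hr - r * r * (h.mul_self 4 4 (by decide)))

/-- The second element of a shortest chain is not a column parallel to a column of `R₁₂`. -/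
lemma false_of_parallel_column (h : HasR12Block P ρ κ) (hmin : NoShortChain m n (N + 2))
    (hx₀ : Left ρ κ x₀) {e : n} {g : m} (he : Forces P ρ κ x₀ (.inr e))
    (hge : Forces P ρ κ (.inr e) (.inl g)) (hg : ForcesRight P ρ κ N (.inl g)) {a : Fin 6}
    (ha : a ∈ ([0, 1, 4, 5] : List (Fin 6))) {r : ℤ} (hr : r = 1 ∨ r = -1)
    (hea : ∀ i, P (ρ i) e = r * P (ρ i) (κ a)) : False := by
  have h' := h.update_column hr hea
  have hR : ∀ x, Right ρ κ x → Right ρ (Function.update κ a e) x :=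
    fun x ↦ right_update_column ha
  have hfe : ∀ f j, j < N → ForcesRight P ρ κ j (.inl f) → deviation P ρ κ f e = 0 := by
    intro f j hj hf
    by_contra hne
    exact h.not_forces_of_chain hmin hx₀ he (by omega) hf hne
  have hg0 : ∀ a ∈ ([0, 1, 4, 5] : List (Fin 6)), deviation P ρ κ g (κ a) = 0 :=
    fun a ha ↦ h.deviation_eq_zero_of_chain hmin (by omega) hg ha
  have hne := fun i j ↦ h.ne_zero_iff i j
  simp only [List.mem_cons, List.not_mem_nil, or_false] at ha
  -- For `a` equal to 1 or 5 the deviation does not involve `κ a`, so `e` becomes a left element and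
  -- starts the shorter chain itself.
  have swap : (∀ f v, deviation P ρ (Function.update κ a e) f v = deviation P ρ κ f v) → False := by
    intro hdev
    refine hmin _ _ _ h' (N + 1) (.inr e) (by omega) ⟨a, by simpa using ha, by simp⟩
      ⟨.inl g, ?_, ?_⟩
    · exact (hdev g e).trans_ne hge
    · exact ForcesRight.transfer (K := N) hR (fun f v j hj hv hfv ↦ hfv)
        (fun f v j hj hf hfv ↦ (hdev f v).trans_ne hfv) N _ le_rfl hg
  rcases ha with rfl | rfl | rfl | rfl
  -- Here `e` becomes a reference column, with deviation zero in every row, and cannot start a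
  -- chain. The change of reference makes `κ 1` force `g` instead, because `P (ρ 0) (κ 1)` is
  -- nonzero.
  · have hdev := h.deviation_update_zero hr hea
    refine hmin _ _ _ h' (N + 1) (.inr (κ 1)) (by omega) ⟨1, by simp, by simp⟩
      ⟨.inl g, ?_, ?_⟩
    · refine (hdev g (κ 1)).trans_ne ?_
      rw [hg0 1 (by simp), zero_sub, neg_ne_zero]
      exact mul_ne_zero (mul_ne_zero (mul_ne_zero (sign_ne_zero hr) hge) ((hne 0 0).2 (by decide)))
        ((hne 0 1).2 (by decide))
    · refine ForcesRight.transfer (K := N) hR (fun f v j hj hv hfv ↦ hfv)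
        (fun f v j hj hf hfv ↦ ?_) N _ le_rfl hg
      rwa [hdev, hfe f j hj hf, mul_zero, zero_mul, zero_mul, sub_zero]
  · exact swap fun f v ↦ by simp [deviation]
  · have hdev := h.deviation_update_four hr hea
    refine hmin _ _ _ h' (N + 1) (.inr (κ 5)) (by omega) ⟨5, by simp, by simp⟩
      ⟨.inl g, ?_, ?_⟩
    · refine (hdev g (κ 5)).trans_ne ?_
      rw [hg0 5 (by simp), zero_sub, neg_ne_zero]
      exact mul_ne_zero (mul_ne_zero (mul_ne_zero (sign_ne_zero hr) hge) ((hne 4 4).2 (by decide)))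
        ((hne 4 5).2 (by decide))
    · refine ForcesRight.transfer (K := N) hR (fun f v j hj hv hfv ↦ hfv)
        (fun f v j hj hf hfv ↦ ?_) N _ le_rfl hg
      rwa [hdev, hfe f j hj hf, mul_zero, zero_mul, zero_mul, sub_zero]
  · exact swap fun f v ↦ by simp [deviation]

/-- A shortest chain does not have a second element that is a column neither parallel to an element
of `R₁₂` nor a third element that is a row vanishing on `R₁₂`. -/
lemma false_of_zero_row (h : HasR12Block P ρ κ) (hmin : NoShortChain m n (N + 2))
    (hx₀ : Left ρ κ x₀) {e : n} {g : m} (he : Forces P ρ κ x₀ (.inr e))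
    (hge : Forces P ρ κ (.inr e) (.inl g)) (hg : ForcesRight P ρ κ N (.inl g))
    (h0 : P (ρ 0) e = 0) (h2 : P (ρ 2) e ≠ 0) (h4 : P (ρ 4) e = 0) (hgz : ∀ j, P g (κ j) = 0) :
    False := by
  classical
  have hdg : ∀ v, deviation P ρ κ g v = P g v := fun v ↦ by simp [deviation, hgz]
  have hge' : P g e ≠ 0 := (hdg e).symm.trans_ne hge
  have hρg : ∀ i, ρ i ≠ g := by
    rintro i rfl
    have key : ∀ i, ∃ j, signedDᵀ j i ≠ 0 := by decide
    obtain ⟨j, hj⟩ := key i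
    exact (h.ne_zero_iff i j).2 hj (hgz j)
  have h' : HasR12Block (P.rowPivot g e) ρ κ := h.rowPivot hge' fun i _ j ↦ by simp [hgz]
  match N, hg with
  | 0, ⟨k, _, hk⟩ => exact hρg k hk.symm
  | N + 1, ⟨.inr v, hgv, hv⟩ =>
    -- The pivot on `(g, e)` fills the zero entry at `(ρ 2, v)`, so that `ρ 2` forces the fourth
    -- element `v` directly.
    refine hmin _ ρ κ h' (N + 1) (.inl (ρ 2)) (by omega) ⟨2, by simp, rfl⟩ ⟨.inr v, ?_, ?_⟩
    · change P.rowPivot g e (ρ 2) v ≠ 0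
      rw [rowPivot_of_ne P (hρg 2), h.entry_eq_zero_of_chain hmin (by omega) hv (by simp), zero_sub,
        neg_ne_zero]
      exact mul_ne_zero (mul_ne_zero h2 hge') hgv
    · refine ForcesRight.transfer (K := N) (fun _ ↦ id) (fun f w j hj hw hfw ↦ ?_)
        (fun f w j hj hf hfw ↦ ?_) N _ le_rfl hv
      · have hgw : P g w = 0 := by
          by_contra hne
          exact hmin P ρ κ h (j + 3) x₀ (by omega) hx₀ ⟨.inr e, he, .inl g, hge, .inr w, hne, hw⟩
        rwa [rowPivot_of_eq_zero]
        rw [hgw, mul_zero]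
      · have hfg : f ≠ g := by
          rintro rfl
          exact h.not_forces_of_chain hmin hx₀ he (by omega) hf hge
        have hfe : deviation P ρ κ f e = 0 := by
          by_contra hne
          exact h.not_forces_of_chain hmin hx₀ he (by omega) hf hne
        rwa [deviation_rowPivot h0 h4 hfg, hfe, zero_mul, zero_mul, sub_zero]

/-- The second element of a shortest chain is not a row in series with a row of `R₁₂`. -/
lemma false_of_series_row (h : HasR12Block P ρ κ) (hmin : NoShortChain m n (N + 2))
    {e : m} {v : n} (hev : Forces P ρ κ (.inl e) (.inr v)) (hv : ForcesRight P ρ κ N (.inr v))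
    {k : Fin 6} (hk : k ∈ ([2, 3] : List (Fin 6))) {r : ℤ} (hr : r = 1 ∨ r = -1)
    (hek : ∀ j, P e (κ j) = r * P (ρ k) (κ j)) : False := by
  have key : ∀ k ∈ ([2, 3] : List (Fin 6)), 0 ≠ k ∧ 4 ≠ k := by decide
  have hdev : ∀ f v, deviation P (Function.update ρ k e) κ f v = deviation P ρ κ f v := by
    intro f v
    simp only [deviation, Function.update_of_ne (key k hk).1, Function.update_of_ne (key k hk).2]
  refine hmin _ _ _ (h.update_row hr hek) (N + 1) (.inl e) (by omega) ⟨k, hk, by simp⟩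
    ⟨.inr v, hev, ?_⟩
  exact ForcesRight.transfer (K := N) (fun x ↦ right_update_row hk)
    (fun f v j hj hv hfv ↦ hfv) (fun f v j hj hf hfv ↦ (hdev f v).trans_ne hfv) N _ le_rfl hv

/-- The second element of a shortest chain is not a row in series with a column of `R₁₂`. -/
lemma false_of_unit_row (h : HasR12Block P ρ κ) (hmin : NoShortChain m n (N + 2))
    (hx₀ : Left ρ κ x₀) {e : m} {v : n} (he : Forces P ρ κ x₀ (.inl e))
    (hev : Forces P ρ κ (.inl e) (.inr v)) (hv : ForcesRight P ρ κ N (.inr v)) {a : Fin 6}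
    (ha : a ∈ ([0, 1, 4, 5] : List (Fin 6))) (hea : ∀ j, P e (κ j) ≠ 0 ↔ j = a) : False := by
  classical
  have hae : P e (κ a) ≠ 0 := (hea a).2 rfl
  have hz : ∀ j, j ≠ a → P e (κ j) = 0 := by
    intro j hj
    by_contra hne
    exact hj ((hea j).1 hne)
  -- The dual exchange: a column pivot, under which the label `κ a` takes over the role of the row
  -- `e`. The block entries stay the same because `e` vanishes on the other columns of R₁₂.
  set P' : Matrix m n ℤ := (Pᵀ.rowPivot (κ a) e)ᵀ with hP'
  have hP'κ : ∀ f j, P' f (κ j) = P f (κ j) := by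
    intro f j
    by_cases hj : j = a
    · rw [hj, hP', transpose_apply, rowPivot_self, transpose_apply]
    · rw [hP', transpose_apply, rowPivot_of_eq_zero, transpose_apply]
      simp [hz j hj]
  have hP'ne : ∀ f w, w ≠ κ a → P' f w = P f w - P f (κ a) * P e (κ a) * P e w := by
    intro f w hw
    rw [hP', transpose_apply, rowPivot_of_ne _ hw]
    simp only [transpose_apply]
    ring
  have h' : HasR12Block P' ρ κ := by
    obtain ⟨s, t, hs, ht, hst⟩ := h.signs
    refine ⟨(h.tu.transpose.rowPivot ?_).transpose, s, t, hs, ht, fun i j ↦ by rw [hP'κ, hst]⟩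
    exact h.entry_mul_self hae
  have hdev : ∀ f w, w ≠ κ a → deviation P' ρ κ f w =
      deviation P ρ κ f w - deviation P ρ κ f (κ a) * P e (κ a) * P e w := by
    intro f w hw
    simp only [deviation, hP'κ, hP'ne _ w hw]
    ring
  obtain ⟨k, hk, hka⟩ : ∃ k ∈ ([2, 3] : List (Fin 6)), P (ρ k) (κ a) ≠ 0 := by
    have key : ∀ a ∈ ([0, 1, 4, 5] : List (Fin 6)), ∃ k ∈ ([2, 3] : List (Fin 6)),
        signedD k a ≠ 0 := by decide
    obtain ⟨k, hk, hka⟩ := key a ha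
    exact ⟨k, hk, (h.ne_zero_iff k a).2 hka⟩
  have hva : v ≠ κ a := by
    rintro rfl
    exact h.not_left_of_chain hmin (by omega) hv ⟨a, ha, rfl⟩
  refine hmin _ _ _ h' (N + 1) (.inl (ρ k)) (by omega) ⟨k, hk, rfl⟩ ⟨.inr v, ?_, ?_⟩
  · change P' (ρ k) v ≠ 0
    rw [hP'ne _ _ hva, h.entry_eq_zero_of_chain hmin (by omega) hv hk, zero_sub, neg_ne_zero]
    exact mul_ne_zero (mul_ne_zero hka hae) hev
  · refine ForcesRight.transfer (K := N) (fun _ ↦ id) (fun f w j hj hw hfw ↦ ?_)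
      (fun f w j hj hf hfw ↦ ?_) N _ le_rfl hv
    · have hwa : w ≠ κ a := by
        rintro rfl
        exact h.not_left_of_chain hmin (by omega) hw ⟨a, ha, rfl⟩
      have hew : P e w = 0 := by
        by_contra hne
        exact h.not_forces_of_chain hmin hx₀ he (by omega) hw hne
      rwa [hP'ne _ _ hwa, hew, mul_zero, sub_zero]
    · have hfa := h.deviation_eq_zero_of_chain hmin (by omega) hf ha
      have hwa : w ≠ κ a := by
        rintro rfl
        exact hfw hfa
      rwa [hdev _ _ hwa, hfa, zero_mul, zero_mul, sub_zero]

end Chain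

/-- The matrix and the block are quantified inside `NoShortChain`, so the induction hypothesis
applies to the pivoted or relabelled data. -/
lemma noShortChain (m n : Type*) (N : ℕ) : NoShortChain m n N := by
  induction N with
  | zero => intro _ _ _ _ k _ hk; omega
  | succ N ih =>
    intro P ρ κ h k x₀ hk hx₀ hx
    have hkN : k = N := by
      by_contra hne
      exact ih P ρ κ h k x₀ (by omega) hx₀ hx
    subst hkN
    match k, hx with
    | 0, hx => exact h.not_right_of_left hx₀ hx
    | 1, ⟨y, hxy, hy⟩ => exact h.not_forces hx₀ hy hxy
    | N + 2, ⟨y, hxy, z, hyz, hz⟩ =>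
      match y, z, hxy, hyz, hz with
      | .inr e, .inl g, hxy, hyz, hz =>
        have hcol : P (ρ 2) e ≠ 0 ∨ P (ρ 3) e ≠ 0 := by
          match x₀, hx₀, hxy with
          | .inl f, ⟨k, hk, hf⟩, hxy =>
            subst hf
            simp only [List.mem_cons, List.not_mem_nil, or_false] at hk
            rcases hk with rfl | rfl
            exacts [.inl hxy, .inr hxy]
        rcases (h.column_cases hcol).2 with ⟨k, hk, hek⟩ | ⟨a, ha, r, hr, hea⟩ | ⟨h0, h2, h4, hz'⟩
        · exact h.false_of_unit_column ih hx₀ hxy hyz hz hk hek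
        · exact h.false_of_parallel_column ih hx₀ hxy hyz hz ha hr hea
        · refine h.false_of_zero_row ih hx₀ hxy hyz hz h0 h2 h4 (hz' g
            (h.deviation_eq_zero_of_chain ih (by omega) hz (by simp))
            (h.deviation_eq_zero_of_chain ih (by omega) hz (by simp)) ?_)
          have : deviation P ρ κ g e = P g e := by simp [deviation, h0, h4]
          exact this.symm.trans_ne hyz
      | .inl e, .inr v, hxy, hyz, hz =>
        have hrow : deviation P ρ κ e (κ 1) ≠ 0 ∨ deviation P ρ κ e (κ 5) ≠ 0 := by
          match x₀, hx₀, hxy with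
          | .inr w, ⟨a, ha, hw⟩, hxy =>
            subst hw
            simp only [List.mem_cons, List.not_mem_nil, or_false] at ha
            rcases ha with rfl | rfl | rfl | rfl
            -- The reference columns `κ 0` and `κ 4` force nothing, so only `κ 1` and `κ 5` can
            -- start the chain.
            exacts [absurd (h.deviation_zero e) hxy, .inl hxy, absurd (h.deviation_four e) hxy,
              .inr hxy]
        rcases (h.row_cases hrow).2 with ⟨a, ha, hea⟩ | ⟨k, hk, r, hr, hek⟩
        · exact h.false_of_unit_row ih hx₀ hxy hyz hz ha hea
        · exact h.false_of_series_row ih hyz hz hk hr hek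

/-- A copy of `R₁₂` in a totally unimodular matrix induces a separation of its rows and columns. -/
theorem exists_separation (h : HasR12Block P ρ κ) :
    ∃ (X : Set m) (Y : Set n), (∀ k ∈ ([2, 3] : List (Fin 6)), ρ k ∈ X) ∧
      (∀ k ∈ ([0, 1, 4, 5] : List (Fin 6)), ρ k ∉ X) ∧
      (∀ k ∈ ([0, 1, 4, 5] : List (Fin 6)), κ k ∈ Y) ∧
      (∀ k ∈ ([2, 3] : List (Fin 6)), κ k ∉ Y) ∧
      (∀ f ∈ X, ∀ v ∉ Y, P f v = 0) ∧ (∀ f ∉ X, ∀ v ∈ Y, deviation P ρ κ f v = 0) := by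
  -- The largest set that is closed under forcing and avoids the right elements of R₁₂.
  set S : Set (m ⊕ n) := {x | ∀ k, ¬ ForcesRight P ρ κ k x} with hS
  have hl : ∀ x, Left ρ κ x → x ∈ S := fun x hx k ↦ noShortChain m n (k + 1) P ρ κ h k x (by simp) hx
  have hr : ∀ x, Right ρ κ x → x ∉ S := fun x hx hxS ↦ hxS 0 hx
  have hf : ∀ x ∈ S, ∀ y ∉ S, ¬ Forces P ρ κ x y := by
    intro x hx y hy hxy
    simp only [hS, Set.mem_ofPred_eq, not_forall, not_not] at hy
    obtain ⟨k, hk⟩ := hy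
    exact hx (k + 1) ⟨y, hxy, hk⟩
  refine ⟨{f : m | (Sum.inl f : m ⊕ n) ∈ S}, {v : n | (Sum.inr v : m ⊕ n) ∈ S}, fun k hk ↦ hl (.inl (ρ k)) ⟨k, hk, rfl⟩,
    fun k hk ↦ hr (.inl (ρ k)) ⟨k, hk, rfl⟩, fun k hk ↦ hl (.inr (κ k)) ⟨k, hk, rfl⟩,
    fun k hk ↦ hr (.inr (κ k)) ⟨k, hk, rfl⟩, fun f hfX v hv ↦ ?_, fun f hfX v hv ↦ ?_⟩
  · by_contra hne
    exact hf (.inl f) hfX (.inr v) hv hne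
  · by_contra hne
    exact hf (.inr v) hv (.inl f) hfX hne

end HasR12Block

end Matroid

/-! ### Representations with unit columns, change of field, and connectivity from blocks. -/

namespace Matroid

open Matrix Set

section UnitColumns

variable {K r α : Type*} {I : Set α} {σ : α → r}

/-- The column `e ∈ I` of `A` is a nonzero multiple of the unit vector at `σ e`, and these unit
vectors are distinct. -/
structure HasUnitColumns [Zero K] (A : Matrix r α K) (I : Set α) (σ : α → r) : Prop where
  ne_zero_iff : ∀ e ∈ I, ∀ f, A f e ≠ 0 ↔ f = σ e
  injOn : InjOn σ I

namespace HasUnitColumns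

/-- The nonzero entries are ±1, so they stay nonzero in every characteristic. -/
lemma map_intCast [Ring K] [Nontrivial K] {Z : Matrix r α ℤ} (hZ : Z.IsTotallyUnimodular)
    (h : HasUnitColumns Z I σ) : HasUnitColumns (Z.map (Int.cast : ℤ → K)) I σ := by
  refine ⟨fun e he f ↦ ?_, h.injOn⟩
  rw [← h.ne_zero_iff e he f, map_apply]
  refine ⟨fun hne h0 ↦ hne (by rw [h0, Int.cast_zero]), fun hne ↦ ?_⟩
  rcases eq_one_or_neg_one (hZ.abs_le_one f e) hne with h1 | h1 <;> simp [h1]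

variable [Field K] {A : Matrix r α K}

lemma mono (h : HasUnitColumns A I σ) {J : Set α} (hJ : J ⊆ I) : HasUnitColumns A J σ :=
  ⟨fun e he ↦ h.ne_zero_iff e (hJ he), h.injOn.mono hJ⟩

variable [Fintype r]

lemma mem_span_iff (h : HasUnitColumns A I σ) {x : r → K} :
    x ∈ Submodule.span K (A.col '' I) ↔ ∀ f ∉ σ '' I, x f = 0 := by
  classical
  constructor
  · intro hx f hf
    induction hx using Submodule.span_induction with
    | mem y hy =>
      obtain ⟨e, he, rfl⟩ := hy
      by_contra hne
      exact hf ⟨e, he, ((h.ne_zero_iff e he f).1 hne).symm⟩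
    | zero => rfl
    | add y z _ _ hy hz => rw [Pi.add_apply, hy, hz, add_zero]
    | smul c y _ hy => rw [Pi.smul_apply, hy, smul_zero]
  · intro hx
    rw [← Finset.univ_sum_single x]
    refine Submodule.sum_mem _ fun f _ ↦ ?_
    by_cases hf : f ∈ σ '' I
    · obtain ⟨e, he, rfl⟩ := hf
      have hne := (h.ne_zero_iff e he (σ e)).2 rfl
      have : Pi.single (σ e) (x (σ e)) = (x (σ e) * (A (σ e) e)⁻¹) • A.col e := by
        ext f
        rw [Pi.smul_apply, col_apply, smul_eq_mul]
        by_cases hf : f = σ e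
        · subst hf
          simp [hne]
        · have h0 : A f e = 0 := by
            by_contra hne'
            exact hf ((h.ne_zero_iff e he f).1 hne')
          simp [hf, h0]
      rw [this]
      exact Submodule.smul_mem _ _ (Submodule.subset_span ⟨e, he, rfl⟩)
    · rw [hx f hf, Pi.single_zero]
      exact Submodule.zero_mem _

lemma linearIndepOn (h : HasUnitColumns A I σ) : LinearIndepOn K A.col I := by
  rw [linearIndepOn_iff_notMem_span]
  intro e he hmem
  refine (h.ne_zero_iff e he (σ e)).2 rfl
    (((h.mono sdiff_subset).mem_span_iff).1 hmem (σ e) ?_)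
  rintro ⟨e', ⟨he', hne⟩, heq⟩
  exact hne (h.injOn he' he heq)

lemma linearIndepOn_insert_iff (h : HasUnitColumns A I σ) {x : α} (hx : x ∉ I) :
    LinearIndepOn K A.col (insert x I) ↔ ∃ f ∉ σ '' I, A f x ≠ 0 := by
  rw [linearIndepOn_insert hx, and_iff_right h.linearIndepOn, h.mem_span_iff]
  simp

/-- Exchanging a unit column for a column spanned by the unit columns. -/
lemma linearIndepOn_exchange_iff (h : HasUnitColumns A I σ) {x b : α} (hx : x ∉ I) (hb : b ∈ I)
    (hxI : ∀ f ∉ σ '' I, A f x = 0) :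
    LinearIndepOn K A.col (insert x (I \ {b})) ↔ A (σ b) x ≠ 0 := by
  rw [(h.mono sdiff_subset).linearIndepOn_insert_iff fun h ↦ hx h.1]
  constructor
  · rintro ⟨f, hf, hne⟩
    have hfI : f ∈ σ '' I := by
      by_contra hfI
      exact hne (hxI f hfI)
    obtain ⟨e, he, rfl⟩ := hfI
    by_cases heb : e = b
    · rwa [heb] at hne
    · exact absurd ⟨e, ⟨he, heb⟩, rfl⟩ hf
  · intro hne
    refine ⟨σ b, ?_, hne⟩
    rintro ⟨e, ⟨he, heb⟩, heq⟩
    exact heb (h.injOn he hb heq)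

end HasUnitColumns

variable [Field K] [DecidableEq r]

lemma map_intCast_rowPivot (Z : Matrix r α ℤ) (g : r) (e : α) :
    (Z.rowPivot g e).map (Int.cast : ℤ → K) = (Z.map (Int.cast : ℤ → K)).rowPivot g e := by
  ext f v
  by_cases hf : f = g <;> simp [Matrix.rowPivot, hf]

/-- Pivoting preserves linear independence of columns. -/
lemma linearIndepOn_rowPivot_iff (A : Matrix r α K) (g : r) (e : α) (J : Set α) :
    LinearIndepOn K (A.rowPivot g e).col J ↔ LinearIndepOn K A.col J := by
  let L : (r → K) →ₗ[K] (r → K) :=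
    { toFun := fun x f ↦ if f = g then x g else x f - A f e * A g e * x g
      map_add' := by
        intro x y
        ext f
        by_cases hf : f = g
        · simp [hf]
        · simp only [hf, if_false, Pi.add_apply]
          ring
      map_smul' := by
        intro c x
        ext f
        by_cases hf : f = g
        · simp [hf]
        · simp only [hf, if_false, Pi.smul_apply, smul_eq_mul, RingHom.id_apply]
          ring }
  have hL : L.ker = ⊥ := by
    rw [LinearMap.ker_eq_bot']
    intro x hx
    have hxg : x g = 0 := by simpa [L] using congr_fun hx g
    ext f
    by_cases hf : f = g
    · rw [hf, hxg, Pi.zero_apply]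
    · simpa [L, hf, hxg] using congr_fun hx f
  have : (A.rowPivot g e).col = L ∘ A.col := by
    ext x f
    simp [L, Matrix.rowPivot]
  rw [this]
  exact LinearMap.linearIndependent_iff (v := fun x : J ↦ A.col x) L hL

/-- A totally unimodular matrix can be pivoted so that given independent columns become unit
columns, without changing linear independence of columns over two given fields. -/
lemma exists_hasUnitColumns {L : Type*} [Field L] [Fintype r] [Nonempty r] {Z : Matrix r α ℤ}
    (hZ : Z.IsTotallyUnimodular) (hI : I.Finite)
    (hZI : LinearIndepOn K (Z.map (Int.cast : ℤ → K)).col I) :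
    ∃ (Z' : Matrix r α ℤ) (σ : α → r), Z'.IsTotallyUnimodular ∧
      (∀ J, LinearIndepOn K (Z'.map (Int.cast : ℤ → K)).col J ↔
        LinearIndepOn K (Z.map (Int.cast : ℤ → K)).col J) ∧
      (∀ J, LinearIndepOn L (Z'.map (Int.cast : ℤ → L)).col J ↔
        LinearIndepOn L (Z.map (Int.cast : ℤ → L)).col J) ∧ HasUnitColumns Z' I σ := by
  classical
  induction I, hI using Set.Finite.induction_on with
  | empty =>
    exact ⟨Z, fun _ ↦ Classical.arbitrary r, hZ, fun _ ↦ Iff.rfl, fun _ ↦ Iff.rfl, by simp, by simp⟩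
  | @insert e I he _ ih =>
    obtain ⟨A, σ, hA, hK, hL, hσ⟩ := ih (hZI.mono (subset_insert _ _))
    rw [← hK, (hσ.map_intCast hA).linearIndepOn_insert_iff he] at hZI
    -- The pivot is found over `K`, but it is the integer ±1, so the same row operations are
    -- legitimate over `L`.
    obtain ⟨g, hg, hge⟩ := hZI
    replace hge : A g e ≠ 0 := fun h0 ↦ hge (by rw [map_apply, h0, Int.cast_zero])
    have hmul := mul_self_of_mem_range_signType_cast (hA.apply g e) hge
    have hσe : ∀ i ∈ I, Function.update σ e g i = σ i := by
      rintro i hi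
      rw [Function.update_of_ne]
      rintro rfl
      exact he hi
    refine ⟨A.rowPivot g e, Function.update σ e g, hA.rowPivot hmul, fun J ↦ ?_, fun J ↦ ?_, ?_, ?_⟩
    · rw [map_intCast_rowPivot, linearIndepOn_rowPivot_iff, hK]
    · rw [map_intCast_rowPivot, linearIndepOn_rowPivot_iff, hL]
    · rintro i (rfl | hi) f
      · rw [Function.update_self]
        by_cases hf : f = g
        · simp [hf, rowPivot_self, hge]
        · rw [rowPivot_of_ne A hf]
          simp only [hf, iff_false, not_not]
          linear_combination (-A f i) * hmul
      · rw [hσe i hi, ← hσ.ne_zero_iff i hi f, rowPivot_of_eq_zero]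
        have : A g i = 0 := by
          by_contra hne
          exact hg ⟨i, hi, ((hσ.ne_zero_iff i hi g).1 hne).symm⟩
        rw [this, mul_zero]
    · rw [injOn_insert he]
      refine ⟨fun i hi j hj hij ↦ hσ.injOn hi hj ?_, ?_⟩
      · rwa [hσe i hi, hσe j hj] at hij
      · rw [Function.update_self]
        rintro ⟨i, hi, hig⟩
        exact hg ⟨i, hi, by rw [← hσe i hi, hig]⟩

/-- Linear independence of the columns of a totally unimodular matrix does not depend on the field.
-/
lemma linearIndepOn_map_intCast (L : Type*) [Field L] [Fintype r] {Z : Matrix r α ℤ}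
    (hZ : Z.IsTotallyUnimodular) (hI : I.Finite)
    (hZI : LinearIndepOn K (Z.map (Int.cast : ℤ → K)).col I) :
    LinearIndepOn L (Z.map (Int.cast : ℤ → L)).col I := by
  rcases isEmpty_or_nonempty r with hr | hr
  · rcases I.eq_empty_or_nonempty with rfl | ⟨i, hi⟩
    · exact linearIndepOn_empty _ _
    · exact absurd (Subsingleton.elim _ _) (hZI.ne_zero hi)
  · obtain ⟨Z', σ, hZ', -, hL, hσ⟩ := exists_hasUnitColumns (L := L) hZ hI hZI
    exact (hL I).1 (hσ.map_intCast hZ').linearIndepOn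

end UnitColumns

/-- A totally unimodular matrix over a ring of characteristic zero has integer entries. -/
lemma exists_int_of_isTotallyUnimodular {R m n : Type*} [CommRing R] [CharZero R]
    {A : Matrix m n R} (hA : A.IsTotallyUnimodular) :
    ∃ Z : Matrix m n ℤ, Z.IsTotallyUnimodular ∧ Z.map (Int.cast : ℤ → R) = A := by
  choose x hx using hA.apply
  have hx' : ∀ i j, (((x i j : SignType) : ℤ) : R) = A i j := fun i j ↦ by
    rw [SignType.intCast_cast, hx]
  refine ⟨Matrix.of fun i j ↦ (x i j : ℤ), ?_, by ext i j; exact hx' i j⟩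
  intro k f g hf hg
  obtain ⟨y, hy⟩ := hA k f g hf hg
  refine ⟨y, Int.cast_injective (α := R) ?_⟩
  rw [SignType.intCast_cast, hy, Int.cast_det]
  congr 1
  ext i j
  simp [hx']

/-- The separation of a represented matroid given by a block decomposition of its representation
over unit columns. -/
lemma conn_add_one_eq_three {K r α : Type*} [Field K] [Fintype r] {M : Matroid α}
    {A : Matrix r α K} {B : Set α} {σ : α → r} (hfin : M.E.Finite)
    (hM : ∀ I ⊆ M.E, M.Indep I ↔ LinearIndepOn K A.col I) (hB : M.IsBase B)
    (hσ : HasUnitColumns A B σ) {X Y : Set α} (hX : X ⊆ B) (hY : Y ⊆ M.E \ B)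
    (hzero : ∀ f ∈ X, ∀ v ∈ (M.E \ B) \ Y, A (σ f) v = 0) {b₀ b₁ e₀ e₁ : α} (hb₀ : b₀ ∈ B \ X)
    (hb₁ : b₁ ∈ B \ X) (he₀ : e₀ ∈ Y) (he₁ : e₁ ∈ Y) (h₀₀ : A (σ b₀) e₀ ≠ 0)
    (h₁₀ : A (σ b₁) e₀ = 0) (h₁₁ : A (σ b₁) e₁ ≠ 0) {c₀ c₁ : K}
    (hdet : ∀ f ∈ B \ X, ∀ v ∈ Y,
      A (σ f) v = A (σ f) e₀ * c₀ * A (σ b₀) v + A (σ f) e₁ * c₁ * A (σ b₁) v) :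
    M.conn (X ∪ Y) + 1 = 3 := by
  have hBE := hB.subset_ground
  have hdisj : ∀ {v}, v ∈ Y → v ∉ B := fun hv ↦ (hY hv).2
  have hrow : ∀ v ∈ M.E \ B, ∀ f ∉ σ '' B, A f v = 0 := by
    intro v hv f hf
    have h := (hB.insert_dep hv).not_indep
    rw [hM _ (insert_subset hv.1 hBE), hσ.linearIndepOn_insert_iff hv.2] at h
    push Not at h
    exact h f hf
  have hnot : ∀ {b}, b ∈ B \ X → σ b ∉ σ '' X := by
    rintro b hb ⟨f, hf, hfb⟩
    exact hb.2 (hσ.injOn (hX hf) hb.1 hfb ▸ hf)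
  have hσX := hσ.mono hX
  have hne : e₁ ≠ e₀ := by
    rintro rfl
    exact h₁₁ h₁₀
  have he₀X : e₀ ∉ X := fun h ↦ hdisj he₀ (hX h)
  have he₁X : e₁ ∉ insert e₀ X := by
    rintro (h | h)
    exacts [hne h, hdisj he₁ (hX h)]
  have hXY : X ∪ Y ⊆ M.E := union_subset (hX.trans hBE) (hY.trans sdiff_subset)
  have hbasis : M.IsBasis (insert e₁ (insert e₀ X)) (X ∪ Y) := by
    have hsub : insert e₁ (insert e₀ X) ⊆ X ∪ Y :=
      insert_subset (.inr he₁) (insert_subset (.inr he₀) subset_union_left)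
    refine Indep.isBasis_of_forall_insert ?_ hsub ?_
    · rw [hM _ (hsub.trans hXY), linearIndepOn_insert he₁X, hσX.linearIndepOn_insert_iff he₀X]
      refine ⟨⟨σ b₀, hnot hb₀, h₀₀⟩, fun hmem ↦ h₁₁ ?_⟩
      have hle : Submodule.span K (A.col '' insert e₀ X) ≤
          (LinearMap.proj (σ b₁) : (r → K) →ₗ[K] K).ker := by
        rw [Submodule.span_le]
        rintro _ ⟨v, rfl | hv, rfl⟩
        · exact h₁₀
        · exact hσX.mem_span_iff.1 (Submodule.subset_span ⟨v, hv, rfl⟩) _ (hnot hb₁)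
      exact hle hmem
    · rintro v ⟨hv, hvI⟩
      have hvY : v ∈ Y := hv.resolve_left fun h ↦ hvI (.inr (.inr h))
      refine ⟨?_, insert_subset (hXY hv) (hsub.trans hXY)⟩
      rw [hM _ (insert_subset (hXY hv) (hsub.trans hXY)), linearIndepOn_insert hvI, not_and, not_not]
      intro _
      -- By `hdet` this combination vanishes in the rows of `B \ X`, so only the unit columns of `X`
      -- are needed to express it.
      have hy : A.col v - (c₀ * A (σ b₀) v) • A.col e₀ - (c₁ * A (σ b₁) v) • A.col e₁ ∈
          Submodule.span K (A.col '' X) := by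
        rw [hσX.mem_span_iff]
        intro f hf
        simp only [Pi.sub_apply, Pi.smul_apply, col_apply, smul_eq_mul]
        by_cases hfB : f ∈ σ '' B
        · obtain ⟨b, hb, rfl⟩ := hfB
          rw [hdet b ⟨hb, fun h ↦ hf ⟨b, h, rfl⟩⟩ v hvY]
          ring
        · rw [hrow v (hY hvY) f hfB, hrow e₀ (hY he₀) f hfB, hrow e₁ (hY he₁) f hfB]
          simp
      have hsum : A.col v = (A.col v - (c₀ * A (σ b₀) v) • A.col e₀ -
          (c₁ * A (σ b₁) v) • A.col e₁) + (c₀ * A (σ b₀) v) • A.col e₀ +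
          (c₁ * A (σ b₁) v) • A.col e₁ := by abel
      rw [hsum]
      refine Submodule.add_mem _ (Submodule.add_mem _
        (Submodule.span_mono (image_mono ?_) hy) ?_) ?_
      · exact (subset_insert _ _).trans (subset_insert _ _)
      · exact Submodule.smul_mem _ _ (Submodule.subset_span ⟨e₀, by simp, rfl⟩)
      · exact Submodule.smul_mem _ _ (Submodule.subset_span ⟨e₁, by simp, rfl⟩)
  have hcobasis : M.IsBasis (B \ X) (M.E \ (X ∪ Y)) := by
    have hsub : B \ X ⊆ M.E \ (X ∪ Y) := by
      rintro b ⟨hb, hbX⟩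
      exact ⟨hBE hb, fun h ↦ h.elim hbX fun h ↦ hdisj h hb⟩
    refine (hB.indep.subset sdiff_subset).isBasis_of_forall_insert hsub ?_
    rintro v ⟨⟨hvE, hvXY⟩, hvB⟩
    have hvB' : v ∉ B := fun h ↦ hvB ⟨h, fun h' ↦ hvXY (.inl h')⟩
    have hsE : insert v (B \ X) ⊆ M.E := insert_subset hvE (sdiff_subset.trans hBE)
    refine ⟨?_, hsE⟩
    rw [hM _ hsE, (hσ.mono sdiff_subset).linearIndepOn_insert_iff hvB]
    push Not
    intro f hf
    by_cases hfB : f ∈ σ '' B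
    · obtain ⟨b, hb, rfl⟩ := hfB
      have hbX : b ∈ X := by
        by_contra hbX
        exact hf ⟨b, ⟨hb, hbX⟩, rfl⟩
      exact hzero b hbX v ⟨⟨hvE, hvB'⟩, fun h ↦ hvXY (.inr h)⟩
    · exact hrow v ⟨hvE, hvB'⟩ f hfB
  -- With these bases, λ = (|X| + 2) + |B \ X| - |B| = 2.
  rw [conn, hbasis.eRk_eq_encard, hcobasis.eRk_eq_encard, ← hB.encard_eq_eRank,
    encard_insert_of_notMem he₁X, encard_insert_of_notMem he₀X,
    ← encard_sdiff_add_encard_of_subset hX]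
  have hBfin := hfin.subset hBE
  rw [(hBfin.subset hX).encard_eq_coe_toFinset_card,
    (hBfin.subset (sdiff_subset (t := X))).encard_eq_coe_toFinset_card]
  norm_cast
  omega

/-! ### From a minor R₁₂ of a regular matroid to the induced separation. -/

/-- The elements `1, …, 6` of `R₁₂`. -/
def R12Base : Set (Fin 12) := {i | (i : ℕ) < 6}

lemma R12_indep_iff (I : Set (Fin 12)) : R12.Indep I ↔ LinearIndepOn (ZMod 2) R12Matrix.col I :=
  Iff.rfl

lemma R12_hasUnitColumns :
    HasUnitColumns R12Matrix R12Base (fun i ↦ ⟨(i : ℕ) % 6, Nat.mod_lt _ (by decide)⟩) := by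
  constructor
  · have key : ∀ e : Fin 12, (e : ℕ) < 6 → ∀ f, R12Matrix f e ≠ 0 ↔
        f = ⟨(e : ℕ) % 6, Nat.mod_lt _ (by decide)⟩ := by decide
    exact key
  · intro i hi j hj hij
    simp only [R12Base, mem_ofPred_eq, Fin.mk.injEq] at hi hj hij
    ext
    omega

lemma R12_isBase : R12.IsBase R12Base := by
  refine Indep.isBase_of_forall_insert (M := R12) R12_hasUnitColumns.linearIndepOn ?_
  rintro e ⟨-, he⟩
  rw [R12_indep_iff, R12_hasUnitColumns.linearIndepOn_insert_iff he]
  rintro ⟨f, hf, -⟩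
  refine hf ⟨Fin.castAdd 6 f, f.2, ?_⟩
  ext
  exact Nat.mod_eq_of_lt f.2

/-- Expresses the support of the block through basis exchanges, a property of the matroid alone, so
that it can be transported to any real representation of a matroid with this minor. -/
lemma R12_indep_exchange_iff (i j : Fin 6) :
    R12.Indep (insert (Fin.natAdd 6 j) (R12Base \ {Fin.castAdd 6 i})) ↔ signedD i j ≠ 0 := by
  have hnot : ∀ j : Fin 6, Fin.natAdd 6 j ∉ R12Base := by
    intro j
    simp [R12Base]
  rw [R12_indep_iff, R12_hasUnitColumns.linearIndepOn_exchange_iff (hnot j) i.2]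
  · have key : ∀ j i : Fin 6, R12Matrix ⟨(Fin.castAdd 6 i : Fin 12) % 6, Nat.mod_lt _ (by decide)⟩
        (Fin.natAdd 6 j) ≠ 0 ↔ signedD i j ≠ 0 := by decide
    exact key j i
  · intro f hf
    refine absurd ⟨Fin.castAdd 6 f, f.2, ?_⟩ hf
    ext
    exact Nat.mod_eq_of_lt f.2

lemma three_le_encard_R12A : 3 ≤ R12A.encard := by
  have h : (({2, 3, 6} : Finset (Fin 12)) : Set (Fin 12)) ⊆ R12A := by
    intro i hi
    simp only [Finset.coe_insert, Finset.coe_singleton, mem_insert_iff, mem_singleton_iff] at hi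
    rcases hi with rfl | rfl | rfl <;> simp [R12A]
  refine le_trans ?_ (encard_le_encard h)
  rw [encard_coe_eq_coe_finsetCard]
  decide

lemma three_le_encard_R12B : 3 ≤ R12B.encard := by
  have h : (({0, 1, 4} : Finset (Fin 12)) : Set (Fin 12)) ⊆ R12B := by
    intro i hi
    simp only [Finset.coe_insert, Finset.coe_singleton, mem_insert_iff, mem_singleton_iff] at hi
    rcases hi with rfl | rfl | rfl <;> simp [R12B]
  refine le_trans ?_ (encard_le_encard h)
  rw [encard_coe_eq_coe_finsetCard]
  decide

lemma R12A_cases {i : Fin 12} (hi : i ∈ R12A) :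
    (∃ k ∈ ([2, 3] : List (Fin 6)), i = Fin.castAdd 6 k) ∨
      ∃ k ∈ ([0, 1, 4, 5] : List (Fin 6)), i = Fin.natAdd 6 k := by
  have key : ∀ i : Fin 12, ((i : ℕ) + 1 = 3 ∨ (i : ℕ) + 1 = 4 ∨ (i : ℕ) + 1 = 7 ∨
      (i : ℕ) + 1 = 8 ∨ (i : ℕ) + 1 = 11 ∨ (i : ℕ) + 1 = 12) →
    (∃ k ∈ ([2, 3] : List (Fin 6)), i = Fin.castAdd 6 k) ∨
      ∃ k ∈ ([0, 1, 4, 5] : List (Fin 6)), i = Fin.natAdd 6 k := by decide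
  exact key i hi

lemma R12B_cases {i : Fin 12} (hi : i ∈ R12B) :
    (∃ k ∈ ([0, 1, 4, 5] : List (Fin 6)), i = Fin.castAdd 6 k) ∨
      ∃ k ∈ ([2, 3] : List (Fin 6)), i = Fin.natAdd 6 k := by
  have key : ∀ i : Fin 12, ((i : ℕ) + 1 = 1 ∨ (i : ℕ) + 1 = 2 ∨ (i : ℕ) + 1 = 5 ∨
      (i : ℕ) + 1 = 6 ∨ (i : ℕ) + 1 = 9 ∨ (i : ℕ) + 1 = 10) →
    (∃ k ∈ ([0, 1, 4, 5] : List (Fin 6)), i = Fin.castAdd 6 k) ∨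
      ∃ k ∈ ([2, 3] : List (Fin 6)), i = Fin.natAdd 6 k := by decide
  exact key i hi

/-- Independence in a minor, in terms of independence in the matroid. -/
lemma exists_indep_map_iff {α β : Type*} {M : Matroid α} {N : Matroid β} {φ : β → α}
    {hφ : InjOn φ N.E} (hN : N.map φ hφ ≤m M) :
    ∃ I : Set α, Disjoint I (φ '' N.E) ∧
      ∀ J ⊆ N.E, N.Indep J ↔ M.Indep (φ '' J ∪ I) := by
  obtain ⟨C, D, hC, -, hCD, hNM⟩ := hN.exists_eq_contract_delete_disjoint
  obtain ⟨I, hI⟩ := M.exists_isBasis C hC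
  have hE : φ '' N.E = (M.E \ C) \ D := by
    rw [← map_ground N φ hφ, hNM]
    rfl
  refine ⟨I, ?_, fun J hJ ↦ ?_⟩
  · rw [hE]
    exact (disjoint_sdiff_right.mono_right sdiff_subset).mono_left hI.subset
  · have hJE : φ '' J ⊆ (M.E \ C) \ D := hE ▸ image_mono hJ
    have hJC : Disjoint C (φ '' J) :=
      disjoint_sdiff_right.mono_right (hJE.trans sdiff_subset)
    have hJD : Disjoint (φ '' J) D := disjoint_sdiff_left.mono_left hJE
    rw [← map_image_indep_iff (hf := hφ) hJ, hNM, delete_indep_iff, hI.contract_indep_iff,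
      and_iff_left hJC, and_iff_left hJD]

theorem IsRegular.exists_isExactSeparation {α : Type*} {M : Matroid α} (hM : M.IsRegular)
    {φ : Fin 12 → α} (hφ : InjOn φ R12.E) (hN : R12.map φ hφ ≤m M) :
    ∃ X Y : Set α, M.IsExactSeparation 3 X Y ∧ φ '' R12A ⊆ X ∧ φ '' R12B ⊆ Y := by
  obtain ⟨hfin, k, A₀, hA₀, hrep₀⟩ := hM
  have hinj : φ.Injective := fun i j hij ↦ hφ (mem_univ i) (mem_univ j) hij
  have hφE : ∀ i, φ i ∈ M.E := fun i ↦ hN.subset ⟨i, mem_univ i, rfl⟩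
  obtain ⟨I, hdisj, hI⟩ := exists_indep_map_iff hN
  replace hI : ∀ J, R12.Indep J ↔ M.Indep (φ '' J ∪ I) := fun J ↦ hI J (subset_univ J)
  have hφI : ∀ i, φ i ∉ I := fun i hi ↦ hdisj.le_bot ⟨hi, ⟨i, mem_univ i, rfl⟩⟩
  obtain ⟨B, hB, hIB⟩ := ((hI _).1 R12_isBase.indep).exists_isBase_superset
  have hBE := hB.subset_ground
  have hrow : ∀ i : Fin 6, φ (Fin.castAdd 6 i) ∈ B := fun i ↦ hIB (.inl ⟨_, i.2, rfl⟩)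
  have hindB := (hrep₀ B hBE).1 hB.indep
  have : Nonempty (Fin k) := by
    by_contra hempty
    rw [not_nonempty_iff] at hempty
    exact hindB.ne_zero (hrow 0) (Subsingleton.elim _ _)
  obtain ⟨Z₀, hZ₀, rfl⟩ := exists_int_of_isTotallyUnimodular hA₀
  obtain ⟨Z, σ, hZ, hrep, -, hσ⟩ := exists_hasUnitColumns (L := ℝ) hZ₀ (hfin.subset hBE) hindB
  replace hσ := hσ.map_intCast (K := ℝ) hZ
  obtain ⟨A, hAZ⟩ : ∃ A, A = Z.map (Int.cast : ℤ → ℝ) := ⟨_, rfl⟩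
  have hZA : ∀ i j, (Z i j : ℝ) = A i j := fun i j ↦ by rw [hAZ, map_apply]
  rw [← hAZ] at hσ
  replace hrep : ∀ J ⊆ M.E, M.Indep J ↔ LinearIndepOn ℝ A.col J :=
    fun J hJ ↦ hAZ ▸ (hrep₀ J hJ).trans (hrep J).symm
  have hcolR : ∀ j : Fin 6, Fin.natAdd 6 j ∉ R12Base := fun j ↦ by simp [R12Base]
  have hinsert : ∀ j : Fin 6,
      ¬ M.Indep (insert (φ (Fin.natAdd 6 j)) (φ '' R12Base ∪ I)) := by
    intro j
    rw [← insert_union, ← image_insert_eq, ← hI]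
    exact (R12_isBase.insert_dep ⟨mem_univ _, hcolR j⟩).not_indep
  have hcolB : ∀ j : Fin 6, φ (Fin.natAdd 6 j) ∉ B :=
    fun j hj ↦ hinsert j (hB.indep.subset (insert_subset hj hIB))
  have hσ' := hσ.mono hIB
  have hentry : ∀ i j : Fin 6,
      A (σ (φ (Fin.castAdd 6 i))) (φ (Fin.natAdd 6 j)) ≠ 0 ↔ signedD i j ≠ 0 := by
    intro i j
    have hjI : φ (Fin.natAdd 6 j) ∉ φ '' R12Base ∪ I := fun h ↦ hcolB j (hIB h)
    -- The basis `B` may exceed the lifted basis of the minor, but columns of R₁₂ are already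
    -- spanned by the latter, so the exchange criterion applies to it.
    have hzero : ∀ f ∉ σ '' (φ '' R12Base ∪ I), A f (φ (Fin.natAdd 6 j)) = 0 := by
      have h := hinsert j
      rw [hrep _ (insert_subset (hφE _) (hIB.trans hBE)), hσ'.linearIndepOn_insert_iff hjI] at h
      push Not at h
      exact h
    have hset : insert (φ (Fin.natAdd 6 j)) ((φ '' R12Base ∪ I) \ {φ (Fin.castAdd 6 i)}) =
        φ '' (insert (Fin.natAdd 6 j) (R12Base \ {Fin.castAdd 6 i})) ∪ I := by
      rw [image_insert_eq, image_sdiff hinj, image_singleton, insert_union, union_sdiff_distrib,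
        sdiff_singleton_eq_self (hφI _)]
    rw [← R12_indep_exchange_iff, hI, ← hset, hrep,
      hσ'.linearIndepOn_exchange_iff hjI (.inl ⟨_, i.2, rfl⟩) hzero]
    exact insert_subset (hφE _) (sdiff_subset.trans (hIB.trans hBE))
  let ρ : Fin 6 → B := fun i ↦ ⟨φ (Fin.castAdd 6 i), hrow i⟩
  let κ : Fin 6 → (M.E \ B : Set α) := fun j ↦ ⟨φ (Fin.natAdd 6 j), hφE _, hcolB j⟩
  let P : Matrix B (M.E \ B : Set α) ℤ := Z.submatrix (fun f ↦ σ f) (fun v ↦ v)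
  have hP : ∀ f v, (P f v : ℝ) = A (σ f) v := fun f v ↦ hZA _ _
  have hblock : HasR12Block P ρ κ := by
    refine ⟨hZ.submatrix _ _, exists_signs (A := P.submatrix ρ κ)
      ((hZ.submatrix _ _).submatrix ρ κ) fun i j ↦ ?_⟩
    rw [← hentry i j, ← hZA, Int.cast_ne_zero]
    rfl
  obtain ⟨X, Y, hXl, hXr, hYl, hYr, hXY, hYX⟩ := hblock.exists_separation
  have hXval : ∀ f : B, (f : α) ∈ Subtype.val '' X ↔ f ∈ X :=
    fun f ↦ Subtype.val_injective.mem_set_image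
  have hYval : ∀ v : (M.E \ B : Set α), (v : α) ∈ Subtype.val '' Y ↔ v ∈ Y :=
    fun v ↦ Subtype.val_injective.mem_set_image
  have hXB : Subtype.val '' X ⊆ B := Subtype.coe_image_subset _ _
  have hYE : Subtype.val '' Y ⊆ M.E \ B := Subtype.coe_image_subset _ _
  have hrowX : ∀ i, φ (Fin.castAdd 6 i) ∈ Subtype.val '' X ∪ Subtype.val '' Y ↔ ρ i ∈ X := by
    intro i
    rw [← hXval]
    exact or_iff_left fun h ↦ (hYE h).2 (hrow i)
  have hcolY : ∀ j, φ (Fin.natAdd 6 j) ∈ Subtype.val '' X ∪ Subtype.val '' Y ↔ κ j ∈ Y := by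
    intro j
    rw [← hYval]
    exact or_iff_right fun h ↦ hcolB j (hXB h)
  have hleft : φ '' R12A ⊆ Subtype.val '' X ∪ Subtype.val '' Y := by
    rintro _ ⟨i, hi, rfl⟩
    rcases R12A_cases hi with ⟨k, hk, rfl⟩ | ⟨k, hk, rfl⟩
    · exact (hrowX k).2 (hXl k hk)
    · exact (hcolY k).2 (hYl k hk)
  have hright : φ '' R12B ⊆ M.E \ (Subtype.val '' X ∪ Subtype.val '' Y) := by
    rintro _ ⟨i, hi, rfl⟩
    refine ⟨hφE i, fun h ↦ ?_⟩
    rcases R12B_cases hi with ⟨k, hk, rfl⟩ | ⟨k, hk, rfl⟩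
    · exact hXr k hk ((hrowX k).1 h)
    · exact hYr k hk ((hcolY k).1 h)
  have hne : ∀ i j, signedD i j ≠ 0 → A (σ (ρ i)) (κ j) ≠ 0 := fun i j h ↦ (hentry i j).2 h
  refine ⟨_, _, ⟨union_sdiff_cancel ?_, disjoint_sdiff_right, ?_, ?_, ?_⟩, hleft, hright⟩
  · exact union_subset (hXB.trans hBE) (hYE.trans sdiff_subset)
  · refine three_le_encard_R12A.trans ?_
    rw [← hinj.encard_image]
    exact encard_le_encard hleft
  · refine three_le_encard_R12B.trans ?_
    rw [← hinj.encard_image]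
    exact encard_le_encard hright
  -- The coefficients `c₀`, `c₁` are the inverses of the diagonal entries at `(ρ 0, κ 0)` and `(ρ 4,
  -- κ 4)`, which are ±1 and hence equal to their inverses; `hdet` then says that the deviation is
  -- zero.
  · refine conn_add_one_eq_three hfin hrep hB hσ hXB hYE (b₀ := ρ 0) (b₁ := ρ 4) (e₀ := κ 0)
      (e₁ := κ 4) (c₀ := P (ρ 0) (κ 0)) (c₁ := P (ρ 4) (κ 4)) ?_ ⟨hrow 0, ?_⟩ ⟨hrow 4, ?_⟩ ?_ ?_
      (hne 0 0 (by decide)) ?_ (hne 4 4 (by decide)) ?_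
    · rintro _ ⟨f, hf, rfl⟩ v ⟨hv, hvY⟩
      have := hXY f hf ⟨v, hv⟩ fun h ↦ hvY ⟨_, h, rfl⟩
      rw [← hP f ⟨v, hv⟩, this, Int.cast_zero]
    · rw [hXval]
      exact hXr 0 (by simp)
    · rw [hXval]
      exact hXr 4 (by simp)
    · rw [hYval]
      exact hYl 0 (by simp)
    · rw [hYval]
      exact hYl 4 (by simp)
    · rw [← hP, hblock.eq_zero (by decide), Int.cast_zero]
    · rintro f ⟨hf, hfX⟩ _ ⟨v, hv, rfl⟩
      have := hYX ⟨f, hf⟩ (fun h ↦ hfX ⟨_, h, rfl⟩) v hv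
      rw [deviation] at this
      have h' : ((P ⟨f, hf⟩ v : ℤ) : ℝ) = P ⟨f, hf⟩ (κ 0) * P (ρ 0) (κ 0) * P (ρ 0) v +
          P ⟨f, hf⟩ (κ 4) * P (ρ 4) (κ 4) * P (ρ 4) v := by
        exact_mod_cast (by linarith : P ⟨f, hf⟩ v = P ⟨f, hf⟩ (κ 0) * P (ρ 0) (κ 0) * P (ρ 0) v +
          P ⟨f, hf⟩ (κ 4) * P (ρ 4) (κ 4) * P (ρ 4) v)
      rw [hP ⟨f, hf⟩ v, hP ⟨f, hf⟩ (κ 0), hP ⟨f, hf⟩ (κ 4), hP (ρ 0) v, hP (ρ 4) v] at h'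
      exact h'

end Matroid

/-! ### Regularity of R₁₂ and its own exact separation. -/

namespace Matroid

open Matrix Set

/-- The minor of a matrix on given lists of rows and columns, by expansion along the first row. -/
def listMinor {m n : Type*} (D : Matrix m n ℤ) : List m → List n → ℤ
  | [], _ => 1
  | r :: rs, cs => (List.ofFn fun j : Fin cs.length ↦
      if D r cs[j] = 0 then 0 else (-1) ^ (j : ℕ) * D r cs[j] * listMinor D rs (cs.eraseIdx j)).sum

lemma eraseIdx_ofFn {n : Type*} {k : ℕ} (g : Fin (k + 1) → n) (j : Fin (k + 1)) :
    (List.ofFn g).eraseIdx j = List.ofFn (g ∘ j.succAbove) := by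
  refine List.ext_getElem (by rw [List.length_eraseIdx]; simp [j.is_le]) fun i h₁ h₂ ↦ ?_
  simp only [List.length_ofFn] at h₂
  rw [List.getElem_eraseIdx]
  split_ifs with h
  · simp only [List.getElem_ofFn, Function.comp_apply]
    simp [Fin.succAbove, Fin.lt_def, h]
  · simp only [List.getElem_ofFn, Function.comp_apply]
    simp [Fin.succAbove, Fin.lt_def, h]

lemma det_submatrix_eq_listMinor {m n : Type*} (D : Matrix m n ℤ) :
    ∀ (k : ℕ) (f : Fin k → m) (g : Fin k → n),
      (D.submatrix f g).det = listMinor D (List.ofFn f) (List.ofFn g)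
  | 0, f, g => by simp [listMinor]
  | k + 1, f, g => by
    rw [det_succ_row_zero, List.ofFn_succ, listMinor, List.sum_ofFn]
    refine Fintype.sum_equiv (finCongr (List.length_ofFn).symm) _ _ fun j ↦ ?_
    simp only [submatrix_apply, finCongr_apply, Fin.getElem_fin, Fin.val_cast, List.getElem_ofFn,
      Fin.eta, submatrix_submatrix]
    split_ifs with h
    · rw [h]
      simp
    · rw [det_submatrix_eq_listMinor D k, eraseIdx_ofFn]
      rfl

lemma ofFn_mem_sublists {k n : ℕ} {f : Fin k → Fin n} (hf : StrictMono f) :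
    List.ofFn f ∈ (List.finRange n).sublists := by
  classical
  have : List.ofFn f = (List.finRange n).filter (fun x ↦ x ∈ List.ofFn f) := by
    refine List.SortedLT.eq_of_mem_iff (List.sortedLT_ofFn_iff.2 hf) ?_ fun x ↦ by simp
    exact ((List.sortedLT_finRange n).pairwise.filter _).sortedLT
  rw [List.mem_sublists, this]
  exact List.filter_sublist

/-- Total unimodularity can be checked on increasing sequences of rows and columns. -/
lemma isTotallyUnimodular_of_strictMono {a b : ℕ} {D : Matrix (Fin a) (Fin b) ℤ}
    (h : ∀ k (f : Fin k → Fin a) (g : Fin k → Fin b), StrictMono f → StrictMono g →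
      |(D.submatrix f g).det| ≤ 1) : D.IsTotallyUnimodular := by
  intro k f g hf hg
  have hmono : ∀ {c : ℕ} {f : Fin k → Fin c}, f.Injective → StrictMono (f ∘ Tuple.sort f) :=
    fun hf ↦ (Tuple.monotone_sort _).strictMono_of_injective (hf.comp (Equiv.injective _))
  have h1 := h k _ _ (hmono hf) (hmono hg)
  have h2 : |((D.submatrix f g).submatrix (Tuple.sort f) (Tuple.sort g)).det| ≤ 1 := h1
  rw [abs_det_submatrix_equiv_equiv] at h2
  rw [abs_le] at h2
  obtain h3 | h3 | h3 : (D.submatrix f g).det = -1 ∨ (D.submatrix f g).det = 0 ∨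
    (D.submatrix f g).det = 1 := by omega
  exacts [⟨-1, by simp [h3]⟩, ⟨0, by simp [h3]⟩, ⟨1, by simp [h3]⟩]

/-- Sublists of `List.finRange 6` stand for increasing index sequences, which leaves C(12,6) = 924
square minors. The recursion of `listMinor` skips zero entries, which helps in this sparse matrix.
-/
lemma listMinor_signedD : ∀ rs ∈ (List.finRange 6).sublists, ∀ cs ∈ (List.finRange 6).sublists,
    rs.length = cs.length → |listMinor signedD rs cs| ≤ 1 := by
  decide +kernel

lemma signedD_isTotallyUnimodular : signedD.IsTotallyUnimodular := by
  refine isTotallyUnimodular_of_strictMono fun k f g hf hg ↦ ?_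
  rw [det_submatrix_eq_listMinor]
  exact listMinor_signedD _ (ofFn_mem_sublists hf) _ (ofFn_mem_sublists hg) (by simp)

/-- The signed representation `[I₆ | D]` of `R₁₂`. -/
def signedR12Matrix : Matrix (Fin 6) (Fin 12) ℤ :=
  (fromCols 1 signedD).submatrix id (finSumFinEquiv (m := 6) (n := 6)).symm

lemma signedR12Matrix_isTotallyUnimodular : signedR12Matrix.IsTotallyUnimodular :=
  ((one_fromCols_isTotallyUnimodular_iff _).2 signedD_isTotallyUnimodular).submatrix _ _

lemma signedR12Matrix_map : signedR12Matrix.map (Int.cast : ℤ → ZMod 2) = R12Matrix := by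
  have h : ∀ (j : Fin 12) (i : Fin 6), ((signedR12Matrix i j : ℤ) : ZMod 2) = R12Matrix i j := by
    decide
  ext i j
  exact h j i

lemma IsTotallyUnimodular.map_intCast {m n R : Type*} [CommRing R] {Z : Matrix m n ℤ}
    (hZ : Z.IsTotallyUnimodular) : (Z.map (Int.cast : ℤ → R)).IsTotallyUnimodular := by
  intro k f g hf hg
  obtain ⟨x, hx⟩ := hZ k f g hf hg
  refine ⟨x, ?_⟩
  rw [submatrix_map, ← Int.cast_det, ← hx, SignType.intCast_cast]

/-- R₁₂ is defined over GF(2), while regularity asks for ℝ. The signed integer matrix reduces to the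
former and maps to the latter, and `linearIndepOn_map_intCast` passes between the fields in both
directions. -/
lemma R12_isRegular : R12.IsRegular := by
  refine ⟨toFinite _, 6, signedR12Matrix.map (Int.cast : ℤ → ℝ),
    IsTotallyUnimodular.map_intCast signedR12Matrix_isTotallyUnimodular, fun I _ ↦ ?_⟩
  rw [R12_indep_iff, ← signedR12Matrix_map]
  exact ⟨linearIndepOn_map_intCast ℝ signedR12Matrix_isTotallyUnimodular (toFinite I),
    linearIndepOn_map_intCast (ZMod 2) signedR12Matrix_isTotallyUnimodular (toFinite I)⟩

lemma R12A_union_R12B : R12A ∪ R12B = univ := by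
  have key : ∀ i : Fin 12, ((i : ℕ) + 1 = 3 ∨ (i : ℕ) + 1 = 4 ∨ (i : ℕ) + 1 = 7 ∨
      (i : ℕ) + 1 = 8 ∨ (i : ℕ) + 1 = 11 ∨ (i : ℕ) + 1 = 12) ∨
      ((i : ℕ) + 1 = 1 ∨ (i : ℕ) + 1 = 2 ∨ (i : ℕ) + 1 = 5 ∨
      (i : ℕ) + 1 = 6 ∨ (i : ℕ) + 1 = 9 ∨ (i : ℕ) + 1 = 10) := by decide
  exact eq_univ_of_forall key

/-- The separation of `R₁₂` itself is the one that `R₁₂` induces in `R₁₂`. -/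
lemma R12_isExactSeparation : R12.IsExactSeparation 3 R12A R12B := by
  obtain ⟨X, Y, h, hX, hY⟩ := R12_isRegular.exists_isExactSeparation (φ := id)
    (injOn_id _) (by rw [map_id]; exact IsMinor.refl)
  rw [image_id] at hX hY
  have hXA : X ⊆ R12A := by
    intro x hx
    have : x ∈ R12A ∪ R12B := R12A_union_R12B ▸ mem_univ x
    exact this.resolve_right fun hxB ↦ h.disjoint.le_bot ⟨hx, hY hxB⟩
  have hYB : Y ⊆ R12B := by
    intro x hx
    have : x ∈ R12A ∪ R12B := R12A_union_R12B ▸ mem_univ x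
    exact this.resolve_left fun hxA ↦ h.disjoint.le_bot ⟨hX hxA, hx⟩
  rwa [hXA.antisymm hX, hYB.antisymm hY] at h

end Matroid

theorem theorem4p1 :
    Matroid.IsRegular Matroid.R12 ∧
      Matroid.IsDecomposer Matroid.R12 3 Matroid.R12A Matroid.R12B
        (fun (α : Type u) (M : Matroid α) ↦ M.IsRegular) :=
  ⟨Matroid.R12_isRegular, Matroid.R12_isExactSeparation,
    fun _ _ hM _ hφ hN ↦ hM.exists_isExactSeparation hφ hN⟩
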